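/- Let $\lambda_t,\lambda_o>0$, $\rho_a\in[0,1]$, $d_{\max}>0$, $0<\theta\le 2\pi$ and $\theta_c>0$, and assume that $k=\theta/\theta_c$ is an integer. A typical receiver is at the origin of the plane; its main lobe is an infinite sector with apex at the origin and angle $\theta$, divided into $k$ coherence sectors of angle $\theta_c$. Transmitters form a homogeneous Poisson point process of density $\lambda_t$; independently of each other and of the positions, each is active with probability $\rho_a$, and the axis of its own main lobe, of angle $\theta$, has a uniformly distributed direction. Obstacles form a homogeneous Poisson point process of density $\lambda_o$ independent of all this. A point of the main lobe of the typical receiver at distance $d$ from the origin is in line of sight (LoS) if its coherence sector contains no obstacle at distance at most $d$ from the origin. A collision occurs if there is a transmitter that is active, has the origin in its main lobe, lies in the main lobe of the typical receiver at distance at most $d_{\max}$ from the origin, and is in LoS. The transmitter of the typical link is not one of these Poisson points; it is uniformly distributed on the circle sector consisting of the points of the main lobe of the typical receiver at distance at most $d_{\max}$. Given its position, at distance $\ell$ from the origin, the typical link is established if this position is in LoS, and $\rho_{c\mid\ell}$ is the conditional probability of a collision given that the link is established. The collision probability $\rho_c$ is the average of $\rho_{c\mid\ell}$ over the position of the typical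 transmitter. Put $\lambda_I=\rho_a\lambda_t\theta/(2\pi)$ and $A_x=\theta_c x^2/2$. Then: (i) for every position of the typical transmitter, at distance $\ell\in(0,d_{\max}]$, the link is established with positive probability, and $$\rho_{c\mid\ell}=1-\left(\frac{\lambda_o+\lambda_I e^{-(\lambda_o+\lambda_I)A_{d_{\max}}}}{\lambda_o+\lambda_I}\right)^{\lceil\theta/\theta_c\rceil-1}\left(e^{-\lambda_I A_\ell}-\frac{\lambda_I e^{\lambda_o A_\ell}}{\lambda_o+\lambda_I}\left(e^{-(\lambda_o+\lambda_I)A_\ell}-e^{-(\lambda_o+\lambda_I)A_{d_{\max}}}\right)\right);$$ (ii) the length of the typical link has density $2\ell/d_{\max}^2$ on $(0,d_{\max}]$; (iii) $\rho_c=\int_0^{d_{\max}}\rho_{c\mid\ell}\,\frac{2\ell}{d_{\max}^2}\,d\ell$, that is, $$\rho_c=1-\int_0^{d_{\max}}\left(\frac{\lambda_o+\lambda_I e^{-(\lambda_o+\lambda_I)\theta_c d_{\max}^2/2}}{\lambda_o+\lambda_I}\right)^{\lceil\theta/\theta_c\rceil-1}\left(e^{-\lambda_I\theta_c\ell^2/2}-\frac{\lambda_I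 e^{\lambda_o A_\ell}}{\lambda_o+\lambda_I}\left(e^{-(\lambda_o+\lambda_I)\theta_c\ell^2/2}-e^{-(\lambda_o+\lambda_I)\theta_c d_{\max}^2/2}\right)\right)\frac{2\ell}{d_{\max}^2}\,d\ell.$$ -/

import Mathlib

open MeasureTheory ProbabilityTheory

namespace MmWave

/-- The open-ended plane sector of all points `r e^{iφ}` with `r > 0` and `a ≤ φ < b`. The plane
is `ℂ`, and the typical receiver is at the origin. -/
def sector (a b : ℝ) : Set ℂ :=
  {z | ∃ r : ℝ, 0 < r ∧ ∃ φ ∈ Set.Ico a b, z = (r : ℂ) * Complex.exp ((φ : ℂ) * Complex.I)}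

/-- The part, up to distance `d`, of the main lobe of the typical receiver: the circle sector of
radius `d` and angle `θ` whose first edge has direction `ψ`. -/
def beamRegion (ψ θ d : ℝ) : Set ℂ := {z | z ∈ sector ψ (ψ + θ) ∧ ‖z‖ ≤ d}

/-- The `i`-th coherence sector (`i = 0, 1, …`) of angle `θc` of the main lobe. -/
def cohSector (ψ θc : ℝ) (i : ℕ) : Set ℂ := sector (ψ + i * θc) (ψ + (i + 1) * θc)

section Poisson

variable {Ω : Type*} [MeasurableSpace Ω]

/-- The number of points of the random point configuration `x 0, x 1, …` that lie in `B`. -/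
noncomputable def pointCount (x : ℕ → Ω → ℂ) (B : Set ℂ) (ω : Ω) : ℕ∞ :=
  {n : ℕ | x n ω ∈ B}.encard

/-- The random points `x 0, x 1, …` form a homogeneous Poisson point process on the plane with
density `lam > 0` per unit area. (Such a process has infinitely many points almost surely, so that
its points can be listed by the natural numbers; no order is prescribed.) -/
structure IsPoissonProcess (P : Measure Ω) (lam : ℝ) (x : ℕ → Ω → ℂ) : Prop where
  measurable : ∀ n, Measurable (x n)
  hasLaw_count : ∀ B : Set ℂ, MeasurableSet B → Bornology.IsBounded B →
    HasLaw (pointCount x B)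
      ((poissonMeasure (Real.toNNReal (lam * volume.real B))).map (Nat.cast : ℕ → ℕ∞)) P
  indep_count : ∀ (m : ℕ) (B : Fin m → Set ℂ), (∀ j, MeasurableSet (B j)) →
    (∀ j, Bornology.IsBounded (B j)) → Pairwise (Function.onFun Disjoint B) →
    iIndepFun (fun j => pointCount x (B j)) P

end Poisson

/-- The random objects of the network: the positions `tx n` of the transmitters, the indicator
`act n` of transmitter `n` being active, the direction angle `dir n` of the axis of its main lobe,
and the positions `obs n` of the obstacles. -/
structure Network (Ω : Type*) where
  tx : ℕ → Ω → ℂ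
  act : ℕ → Ω → Bool
  dir : ℕ → Ω → ℝ
  obs : ℕ → Ω → ℂ

namespace Network

variable {Ω : Type*} [MeasurableSpace Ω]

/-- The law of the network: transmitters and obstacles are Poisson with densities `lamT` and
`lamO`, transmitters are active with probability `ρa`, their beams have uniform directions, and
all of these are independent. -/
structure IsRandomNetwork (N : Network Ω) (P : Measure Ω) (lamT lamO ρa : ℝ) : Prop where
  poisson_tx : IsPoissonProcess P lamT N.tx
  poisson_obs : IsPoissonProcess P lamO N.obs
  measurable_act : ∀ n, Measurable (N.act n)
  prob_act : ∀ n, P.real {ω | N.act n ω = true} = ρa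
  measurable_dir : ∀ n, Measurable (N.dir n)
  law_dir : ∀ n, HasLaw (N.dir n) (volume[|Set.Ioc (-Real.pi) Real.pi]) P
  indep_act : iIndepFun N.act P
  indep_dir : iIndepFun N.dir P
  indep_tx_act : IndepFun (fun ω n => N.tx n ω) (fun ω n => N.act n ω) P
  indep_tx_act_dir :
    IndepFun (fun ω => ((fun n => N.tx n ω), (fun n => N.act n ω))) (fun ω n => N.dir n ω) P
  indep_network_obs :
    IndepFun (fun ω => ((fun n => N.tx n ω), (fun n => N.act n ω), (fun n => N.dir n ω)))
      (fun ω n => N.obs n ω) P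

/-- Blockage model: a point `z` of the main lobe of the typical receiver, which consists of
`⌈θ / θc⌉` coherence sectors, is in line of sight if no obstacle of its own coherence sector is at
distance at most `‖z‖` from the origin. -/
def LoS (N : Network Ω) (ψ θ θc : ℝ) (ω : Ω) (z : ℂ) : Prop :=
  ∀ i < ⌈θ / θc⌉₊, z ∈ cohSector ψ θc i →
    ∀ m, N.obs m ω ∈ cohSector ψ θc i → ‖z‖ < ‖N.obs m ω‖

/-- The typical link, with its transmitter at `z`, is established: `z` is in line of sight. -/
def established (N : Network Ω) (ψ θ θc : ℝ) (z : ℂ) : Set Ω := {ω | N.LoS ψ θ θc ω z}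

/-- Collision: some transmitter is active, has the origin in its main lobe (of angle `θ`), lies in
the main lobe of the typical receiver and within the interference range `d`, and is in line of
sight. -/
def collision (N : Network Ω) (ψ θ θc d : ℝ) : Set Ω :=
  {ω | ∃ n, N.act n ω = true ∧
    InnerProductGeometry.angle (Complex.exp ((N.dir n ω : ℂ) * Complex.I)) (0 - N.tx n ω) ≤ θ / 2 ∧
    N.tx n ω ∈ sector ψ (ψ + θ) ∧ ‖N.tx n ω‖ ≤ d ∧ N.LoS ψ θ θc ω (N.tx n ω)}

/-- The conditional collision probability, given that the typical link with transmitter at `z` is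
established. -/
noncomputable def condCollisionProb (N : Network Ω) (P : Measure Ω) (ψ θ θc d : ℝ) (z : ℂ) : ℝ :=
  (P[|N.established ψ θ θc z]).real (N.collision ψ θ θc d)

end Network

/-- The law of the position of the typical transmitter: uniform on the circle sector of angle `θ`
and radius `d` at which the typical receiver is pointing. -/
noncomputable def typicalTxLaw (ψ θ d : ℝ) : Measure ℂ := volume[|beamRegion ψ θ d]

/-- The collision probability: the conditional collision probability of the established typical
link, averaged over the position of the typical transmitter. -/
noncomputable def Network.collisionProb {Ω : Type*} [MeasurableSpace Ω] (N : Network Ω)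
    (P : Measure Ω) (ψ θ θc d : ℝ) : ℝ :=
  ∫ z, N.condCollisionProb P ψ θ θc d z ∂(typicalTxLaw ψ θ d)

/-- The closed-form expression in the length `l` for the conditional collision probability. -/
noncomputable def condFormula (lamI lamO θ θc d l : ℝ) : ℝ :=
  1 - ((lamO + lamI * Real.exp (-(lamO + lamI) * (θc * d ^ 2 / 2))) / (lamO + lamI))
        ^ (⌈θ / θc⌉₊ - 1) *
      (Real.exp (-lamI * (θc * l ^ 2 / 2)) -
        lamI * Real.exp (lamO * (θc * l ^ 2 / 2)) / (lamO + lamI) *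
          (Real.exp (-(lamO + lamI) * (θc * l ^ 2 / 2)) -
            Real.exp (-(lamO + lamI) * (θc * d ^ 2 / 2))))

end MmWave

namespace MmWave

open Real Set

/-! Fix the obstacles. In coherence sector `i` the points in line of sight within range form, up to
a null arc, a circle sector of radius `Y_i`: the distance to the nearest obstacle of that sector,
truncated at `d` (`clearance`). The visible region therefore has area `∑ i, θc / 2 * Y_i ^ 2`
(`volume_real_visibleRegion`).

The transmitters that are active and aim at the origin behave like a thinned Poisson process of
density `λ_I`, so given the obstacles there is no collision with probability `exp (-λ_I * area)`
(`measure_void_thinned`), a product over the sectors.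

The `Y_i` are independent because void events of disjoint regions are (`iIndepFun_clearance`), and
`P (x ≤ Y_i) = exp (-λ_o θc x ^ 2 / 2)` for `0 ≤ x ≤ d`. If the typical transmitter lies at distance
`ℓ` in sector `j`, the link is established exactly when `ℓ ≤ Y_j`, up to a null event. The
probability of an established link without collision thus factors into `k - 1` full moments of `exp
(-λ_I θc Y ^ 2 / 2)` and one moment restricted to `ℓ ≤ Y_j`. Both kinds come from
`setLIntegral_exp_of_tail`, with lower limit `0` or `ℓ`. Dividing by `exp (-λ_o θc ℓ ^ 2 / 2)` gives
(i). Polar coordinates give the law of `ℓ`, against which (i) is integrated. -/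

/-! ### Sectors, their areas, and beam directions -/

/-- Every half-open interval of length `2π` is a fundamental domain for translation by `2πℤ`. This
moves the window `(-π, π]` of `Complex.arg` to one that suits a given sector or point. -/
theorem volume_inter_Ioc_of_periodic {A : Set ℝ} (hA : MeasurableSet A)
    (hp : Function.Periodic (fun x => x ∈ A) (2 * π)) (s t : ℝ) :
    volume (A ∩ Ioc s (s + 2 * π)) = volume (A ∩ Ioc t (t + 2 * π)) := by
  refine (isAddFundamentalDomain_Ioc two_pi_pos s).measure_set_eq
    (isAddFundamentalDomain_Ioc two_pi_pos t) hA fun g => ?_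
  obtain ⟨_, n, rfl⟩ := g
  ext x
  have := hp.zsmul n x
  simp only [eq_iff_iff] at this
  simpa [AddSubmonoid.vadd_def, AddSubgroup.vadd_def, add_comm] using this

/-- Within one turn starting at `ψ`, the angle of a point is unique and equals the representative of
its argument there. With a common `ψ`, all coherence sectors are read off one angular coordinate. -/
theorem mem_sector_iff {ψ a b : ℝ} (ha : ψ ≤ a) (hb : b ≤ ψ + 2 * π) (z : ℂ) :
    z ∈ sector a b ↔ z ≠ 0 ∧ toIcoMod two_pi_pos ψ z.arg ∈ Ico a b := by
  constructor
  · rintro ⟨r, hr, φ, hφ, rfl⟩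
    have h1 : ((r : ℂ) * Complex.exp ((φ : ℂ) * Complex.I)).arg =
        φ - toIocDiv two_pi_pos (-π) φ • (2 * π) := by
      rw [Complex.arg_real_mul _ hr, Complex.arg_exp_mul_I]
      rfl
    rw [h1, toIcoMod_sub_zsmul, (toIcoMod_eq_self two_pi_pos).2 ⟨ha.trans hφ.1, hφ.2.trans_le hb⟩]
    exact ⟨by simp [hr.ne'], hφ⟩
  · rintro ⟨hz, h⟩
    refine ⟨‖z‖, norm_pos_iff.2 hz, _, h, ?_⟩
    have h1 : toIcoMod two_pi_pos ψ z.arg =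
      z.arg - toIcoDiv two_pi_pos ψ z.arg • (2 * π) := rfl
    rw [h1]
    push_cast
    have := Complex.exp_mul_I_periodic.sub_zsmul_eq (x := (z.arg : ℂ)) (toIcoDiv two_pi_pos ψ z.arg)
    simp only [zsmul_eq_mul] at this ⊢
    rw [this, Complex.norm_mul_exp_arg_mul_I]

theorem measurable_toIcoMod (ψ : ℝ) : Measurable (toIcoMod two_pi_pos ψ) := by
  have : toIcoMod two_pi_pos ψ = fun x => ψ + Int.fract ((x - ψ) / (2 * π)) * (2 * π) := by
    ext x
    exact toIcoMod_eq_add_fract_mul two_pi_pos ψ x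
  rw [this]
  fun_prop

theorem measurableSet_sector {a b : ℝ} (hb : b ≤ a + 2 * π) : MeasurableSet (sector a b) := by
  have : sector a b = {0}ᶜ ∩ (fun z : ℂ => toIcoMod two_pi_pos a z.arg) ⁻¹' Ico a b := by
    ext z
    rw [mem_sector_iff le_rfl hb]
    rfl
  rw [this]
  exact (measurableSet_singleton 0).compl.inter
    (((measurable_toIcoMod a).comp Complex.measurable_arg) measurableSet_Ico)

theorem volume_toIcoMod_mem_Ico {a b : ℝ} (hb : b ≤ a + 2 * π) :
    volume (toIcoMod two_pi_pos a ⁻¹' Ico a b ∩ Ioo (-π) π) = ENNReal.ofReal (b - a) := by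
  have h1 : (toIcoMod two_pi_pos a ⁻¹' Ico a b ∩ Ioo (-π) π : Set ℝ) =ᵐ[volume]
      (toIcoMod two_pi_pos a ⁻¹' Ico a b ∩ Ioc (-π) (-π + 2 * π) : Set ℝ) := by
    rw [show -π + 2 * π = π by ring]
    exact (ae_eq_refl _).inter Ioo_ae_eq_Ioc
  rw [measure_congr h1, volume_inter_Ioc_of_periodic (measurable_toIcoMod a measurableSet_Ico)
    (fun x => by simp) (-π) a]
  have h2 : (toIcoMod two_pi_pos a ⁻¹' Ico a b ∩ Ioc a (a + 2 * π) : Set ℝ) =ᵐ[volume]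
      (toIcoMod two_pi_pos a ⁻¹' Ico a b ∩ Ico a (a + 2 * π) : Set ℝ) :=
    (ae_eq_refl _).inter Ico_ae_eq_Ioc.symm
  rw [measure_congr h2, ← Real.volume_Ico]
  congr 1
  ext φ
  constructor
  · rintro ⟨h, h'⟩
    rwa [mem_preimage, (toIcoMod_eq_self two_pi_pos).2 h'] at h
  · intro h
    have h' : φ ∈ Ico a (a + 2 * π) := ⟨h.1, h.2.trans_le hb⟩
    exact ⟨by rwa [mem_preimage, (toIcoMod_eq_self two_pi_pos).2 h'], h'⟩

/-- Integration of a radial function over a sector, in polar coordinates. -/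
theorem setLIntegral_sector_norm {a b : ℝ} (hb : b ≤ a + 2 * π) {f : ℝ → ENNReal}
    (hf : Measurable f) :
    ∫⁻ z in sector a b, f ‖z‖ = ENNReal.ofReal (b - a) * ∫⁻ r in Ioi 0, ENNReal.ofReal r * f r := by
  rw [← lintegral_indicator (measurableSet_sector hb), ← Complex.lintegral_comp_polarCoord_symm,
    polarCoord_target]
  have h1 : ∀ p ∈ Ioi (0 : ℝ) ×ˢ Ioo (-π) π, ENNReal.ofReal p.1 •
      (sector a b).indicator (fun z => f ‖z‖) (Complex.polarCoord.symm p) =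
      (ENNReal.ofReal p.1 * f p.1) *
        (toIcoMod two_pi_pos a ⁻¹' Ico a b).indicator 1 p.2 := by
    rintro ⟨r, φ⟩ ⟨hr, hφ⟩
    simp only [mem_Ioi] at hr
    have h2 : Complex.polarCoord.symm (r, φ) = r * Complex.exp (φ * Complex.I) := by
      rw [Complex.polarCoord_symm_apply, Complex.exp_mul_I]
      simp
    have h3 : (Complex.polarCoord.symm (r, φ)).arg = φ := by
      rw [h2, Complex.arg_real_mul _ hr, Complex.arg_exp_mul_I]
      exact (toIocMod_eq_self two_pi_pos).2 ⟨hφ.1, by linarith [hφ.2]⟩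
    have h4 : ‖Complex.polarCoord.symm (r, φ)‖ = r := by
      rw [Complex.norm_polarCoord_symm, abs_of_pos hr]
    have h5 : Complex.polarCoord.symm (r, φ) ≠ 0 := by
      rw [← norm_pos_iff, h4]; exact hr
    simp only [indicator, mem_sector_iff le_rfl hb, h3, h4, h5, smul_eq_mul, mem_preimage,
      ne_eq, not_false_eq_true, true_and]
    split_ifs <;> simp
  rw [setLIntegral_congr_fun (measurableSet_Ioi.prod measurableSet_Ioo) h1, Measure.volume_eq_prod,
    ← Measure.prod_restrict, lintegral_prod_mul
      (f := fun r => ENNReal.ofReal r * f r) (by fun_prop)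
      (measurable_one.indicator (measurable_toIcoMod a measurableSet_Ico)).aemeasurable,
    lintegral_indicator_one (measurable_toIcoMod a measurableSet_Ico),
    Measure.restrict_apply (measurable_toIcoMod a measurableSet_Ico), mul_comm]
  congr 1
  exact volume_toIcoMod_mem_Ico hb

theorem lintegral_Ioc_ofReal_id {x : ℝ} (hx : 0 ≤ x) :
    ∫⁻ r in Ioc 0 x, ENNReal.ofReal r = ENNReal.ofReal (x ^ 2 / 2) := by
  rw [← ofReal_integral_eq_lintegral_ofReal, ← intervalIntegral.integral_of_le hx, integral_id]
  · simp
  · exact (intervalIntegrable_iff_integrableOn_Ioc_of_le hx).1 intervalIntegral.intervalIntegrable_id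
  · exact (ae_restrict_iff' measurableSet_Ioc).2 (ae_of_all _ fun r hr => hr.1.le)

theorem volume_sector_inter_preimage_norm {a b : ℝ} (hb : b ≤ a + 2 * π) {S : Set ℝ}
    (hS : MeasurableSet S) :
    volume (sector a b ∩ (fun z : ℂ => ‖z‖) ⁻¹' S) =
      ENNReal.ofReal (b - a) * ∫⁻ r in S ∩ Ioi 0, ENNReal.ofReal r := by
  have h := setLIntegral_sector_norm hb (f := S.indicator 1) (measurable_one.indicator hS)
  have e1 : (fun z : ℂ => S.indicator (1 : ℝ → ENNReal) ‖z‖) =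
      ((fun z : ℂ => ‖z‖) ⁻¹' S).indicator 1 := rfl
  have e2 : (fun r => ENNReal.ofReal r * S.indicator (1 : ℝ → ENNReal) r) =
      S.indicator fun r => ENNReal.ofReal r := by
    ext r; by_cases hr : r ∈ S <;> simp [hr]
  have hm : MeasurableSet ((fun z : ℂ => ‖z‖) ⁻¹' S) := measurable_norm hS
  rw [e1, e2, lintegral_indicator_one hm, Measure.restrict_apply hm, lintegral_indicator hS,
    Measure.restrict_restrict hS] at h
  rw [inter_comm, h]

theorem volume_sector_inter_le {a b x : ℝ} (hb : b ≤ a + 2 * π) (hx : 0 ≤ x) :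
    volume (sector a b ∩ {z | ‖z‖ ≤ x}) = ENNReal.ofReal ((b - a) * x ^ 2 / 2) := by
  have h := volume_sector_inter_preimage_norm hb (S := Iic x) measurableSet_Iic
  rw [inter_comm (Iic x), Ioi_inter_Iic, lintegral_Ioc_ofReal_id hx] at h
  refine h.trans ?_
  rw [← ENNReal.ofReal_mul' (by positivity), mul_div_assoc]

/-- The bounding arc is null, so the value is that of the closed sector. This agreement is what
makes strict and weak distance inequalities interchangeable later. -/
theorem volume_sector_inter_lt {a b x : ℝ} (hb : b ≤ a + 2 * π) (hx : 0 ≤ x) :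
    volume (sector a b ∩ {z | ‖z‖ < x}) = ENNReal.ofReal ((b - a) * x ^ 2 / 2) := by
  have h := volume_sector_inter_preimage_norm hb (S := Iio x) measurableSet_Iio
  rw [inter_comm (Iio x), Ioi_inter_Iio, setLIntegral_congr Ioo_ae_eq_Ioc,
    lintegral_Ioc_ofReal_id hx] at h
  refine h.trans ?_
  rw [← ENNReal.ofReal_mul' (by positivity), mul_div_assoc]

theorem cohSector_mem_iff {ψ θ θc : ℝ} {k : ℕ} (hθc : 0 < θc) (hk : k * θc = θ)
    (hθ : θ ≤ 2 * π) {i : ℕ} (hi : i < k) (z : ℂ) :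
    z ∈ cohSector ψ θc i ↔
      z ≠ 0 ∧ toIcoMod two_pi_pos ψ z.arg ∈ Ico (ψ + i * θc) (ψ + (i + 1) * θc) := by
  refine mem_sector_iff (by nlinarith [i.cast_nonneg (α := ℝ)]) ?_ z
  have : ((i : ℝ) + 1) ≤ k := by exact_mod_cast hi
  nlinarith

theorem disjoint_cohSector {ψ θ θc : ℝ} {k : ℕ} (hθc : 0 < θc) (hk : k * θc = θ)
    (hθ : θ ≤ 2 * π) {i j : ℕ} (hi : i < k) (hj : j < k) (hij : i ≠ j) :
    Disjoint (cohSector ψ θc i) (cohSector ψ θc j) := by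
  rw [Set.disjoint_left]
  intro z h1 h2
  rw [cohSector_mem_iff hθc hk hθ hi] at h1
  rw [cohSector_mem_iff hθc hk hθ hj] at h2
  obtain ⟨-, h1, h1'⟩ := h1
  obtain ⟨-, h2, h2'⟩ := h2
  rcases lt_or_gt_of_ne hij with h | h
  · have : ((i : ℝ) + 1) ≤ j := by exact_mod_cast h
    nlinarith
  · have : ((j : ℝ) + 1) ≤ i := by exact_mod_cast h
    nlinarith

theorem mem_beam_iff_exists {ψ θ θc : ℝ} {k : ℕ} (hθc : 0 < θc) (hk : k * θc = θ)
    (hθ : θ ≤ 2 * π) (z : ℂ) :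
    z ∈ sector ψ (ψ + θ) ↔ ∃ i < k, z ∈ cohSector ψ θc i := by
  rw [mem_sector_iff le_rfl (by linarith)]
  constructor
  · rintro ⟨hz, h1, h2⟩
    set α := toIcoMod two_pi_pos ψ z.arg
    have h0 : 0 ≤ (α - ψ) / θc := div_nonneg (by linarith) hθc.le
    -- The index of the coherence sector is the number of whole angles `θc` between `ψ` and the
    -- direction of `z`.
    have hlt : ⌊(α - ψ) / θc⌋₊ < k := by
      rw [Nat.floor_lt h0, div_lt_iff₀ hθc]
      linarith
    refine ⟨_, hlt, (cohSector_mem_iff hθc hk hθ hlt z).2 ⟨hz, ?_, ?_⟩⟩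
    · have := Nat.floor_le h0
      rw [le_div_iff₀ hθc] at this
      linarith
    · have := Nat.lt_floor_add_one ((α - ψ) / θc)
      rw [div_lt_iff₀ hθc] at this
      linarith
  · rintro ⟨i, hi, h⟩
    obtain ⟨hz, h1, h2⟩ := (cohSector_mem_iff hθc hk hθ hi z).1 h
    have : ((i : ℝ) + 1) ≤ k := by exact_mod_cast hi
    exact ⟨hz, by nlinarith [i.cast_nonneg (α := ℝ)], by nlinarith⟩

/-- In the window of length `2π` centred at `arg w`, the unoriented angle is `|φ - arg w|`, so the
condition cuts out an interval of length `θ`. -/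
theorem volume_angle_le {w : ℂ} (hw : w ≠ 0) {θ : ℝ} (hθ' : θ ≤ 2 * π) :
    volume ({φ : ℝ | InnerProductGeometry.angle (Complex.exp (φ * Complex.I)) w ≤ θ / 2} ∩
      Ioc (-π) π) = ENNReal.ofReal θ := by
  have hmeas : MeasurableSet
      {φ : ℝ | InnerProductGeometry.angle (Complex.exp (φ * Complex.I)) w ≤ θ / 2} := by
    have : Continuous fun φ : ℝ => InnerProductGeometry.angle (Complex.exp (φ * Complex.I)) w := by
      rw [continuous_iff_continuousAt]
      intro φ
      have h1 : ContinuousAt (fun φ : ℝ => Complex.exp (φ * Complex.I)) φ := by fun_prop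
      exact (InnerProductGeometry.continuousAt_angle
        (x := (Complex.exp (φ * Complex.I), w)) (by simp) hw).comp
          (f := fun φ : ℝ => (Complex.exp (φ * Complex.I), w)) (h1.prodMk continuousAt_const)
    exact this.measurable measurableSet_Iic
  have h1 := volume_inter_Ioc_of_periodic hmeas (fun x => by
    have := Complex.exp_mul_I_periodic (x : ℂ)
    simp only [mem_ofPred_eq]
    push_cast
    rw [show Complex.exp (((x : ℂ) + 2 * π) * Complex.I) = Complex.exp (x * Complex.I) from this])
    (-π) (w.arg - π)
  rw [show -π + 2 * π = π by ring, show w.arg - π + 2 * π = w.arg + π by ring] at h1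
  rw [h1]
  have h2 : ({φ : ℝ | InnerProductGeometry.angle (Complex.exp (φ * Complex.I)) w ≤ θ / 2} ∩
      Ioc (w.arg - π) (w.arg + π) : Set ℝ) =
      Icc (w.arg - θ / 2) (w.arg + θ / 2) ∩ Ioc (w.arg - π) (w.arg + π) := by
    ext φ
    refine and_congr_left fun hφ => ?_
    rw [mem_ofPred_eq, Complex.angle_eq_abs_arg (by simp) hw]
    have h3 : Complex.exp (φ * Complex.I) / w =
        ((‖w‖⁻¹ : ℝ) : ℂ) * Complex.exp (((φ - w.arg : ℝ) : ℂ) * Complex.I) := by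
      conv_lhs => rw [← Complex.norm_mul_exp_arg_mul_I w]
      push_cast
      rw [sub_mul, Complex.exp_sub]
      field_simp
    rw [h3, Complex.arg_real_mul _ (by simpa using hw), Complex.arg_exp_mul_I,
      (toIocMod_eq_self two_pi_pos).2 ⟨by linarith [hφ.1], by linarith [hφ.2]⟩, abs_le, mem_Icc]
    constructor <;> rintro ⟨h, h'⟩ <;> constructor <;> linarith
  have h4 : (Icc (w.arg - θ / 2) (w.arg + θ / 2) ∩ Ioc (w.arg - π) (w.arg + π) : Set ℝ)
      =ᵐ[volume] (Icc (w.arg - θ / 2) (w.arg + θ / 2) ∩ Icc (w.arg - π) (w.arg + π) : Set ℝ) :=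
    (ae_eq_refl _).inter Ioc_ae_eq_Icc
  rw [h2, measure_congr h4, inter_eq_self_of_subset_left
    (Icc_subset_Icc (by linarith) (by linarith)), Real.volume_Icc]
  congr 1
  ring

/-! ### Poisson generating function and void probabilities -/

theorem lintegral_comp_prodMk_of_indepFun {Ω α β : Type*} [MeasurableSpace Ω] [MeasurableSpace α]
    [MeasurableSpace β] {P : Measure Ω} [IsProbabilityMeasure P] {X : Ω → α} {Y : Ω → β}
    (hX : Measurable X) (hY : Measurable Y) (h : IndepFun X Y P) {f : α × β → ENNReal}
    (hf : Measurable f) :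
    ∫⁻ ω, f (X ω, Y ω) ∂P = ∫⁻ ω, ∫⁻ ω', f (X ω, Y ω') ∂P ∂P := by
  have : IsProbabilityMeasure (P.map Y) := Measure.isProbabilityMeasure_map hY.aemeasurable
  rw [← lintegral_map (f := f) (g := fun ω => (X ω, Y ω)) hf (hX.prodMk hY),
    (indepFun_iff_map_prod_eq_prod_map_map hX.aemeasurable hY.aemeasurable).1 h,
    lintegral_prod _ hf.aemeasurable, lintegral_map hf.lintegral_prod_right' hX]
  refine lintegral_congr fun ω => ?_
  rw [lintegral_map (by fun_prop) hY]

theorem lintegral_pow_poissonMeasure (r : NNReal) {c : ℝ} (hc : 0 ≤ c) :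
    ∫⁻ n, ENNReal.ofReal c ^ n ∂poissonMeasure r = ENNReal.ofReal (exp (-((1 - c) * r))) := by
  have h0 : HasSum (fun n : ℕ => exp (-r) * r ^ n / n.factorial * c ^ n)
      (exp (-((1 - c) * r))) := by
    have := (NormedSpace.expSeries_div_hasSum_exp ((r : ℝ) * c)).mul_left (exp (-r))
    rw [← Real.exp_eq_exp_ℝ, ← Real.exp_add] at this
    rw [show -((1 - c) * r) = -(r : ℝ) + r * c by ring]
    have e : (fun n : ℕ => exp (-r) * r ^ n / n.factorial * c ^ n) =
        fun n : ℕ => exp (-r) * (((r : ℝ) * c) ^ n / n.factorial) := by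
      ext n
      rw [mul_pow]
      ring
    rwa [e]
  rw [poissonMeasure, lintegral_sum_measure]
  simp_rw [lintegral_smul_measure, lintegral_dirac, smul_eq_mul]
  rw [← h0.tsum_eq, ENNReal.ofReal_tsum_of_nonneg (fun n => by positivity) h0.summable]
  refine tsum_congr fun n => ?_
  rw [← ENNReal.ofReal_pow hc, ← ENNReal.ofReal_mul (by positivity)]

section Poisson

variable {Ω : Type*} [MeasurableSpace Ω] {P : Measure Ω} {lam : ℝ} {x : ℕ → Ω → ℂ} {B : Set ℂ}

/-- If each point is harmless with probability `c`, independently, this is the probability that all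
points in `B` are harmless. It replaces a thinning theorem for point processes. -/
theorem IsPoissonProcess.lintegral_pow_pointCount (hx : IsPoissonProcess P lam x) (hlam : 0 ≤ lam)
    (hB : MeasurableSet B) (hb : Bornology.IsBounded B) {c : ℝ} (hc : 0 ≤ c) :
    ∫⁻ ω, ENNReal.ofReal c ^ (pointCount x B ω).toNat ∂P =
      ENNReal.ofReal (exp (-((1 - c) * (lam * volume.real B)))) := by
  have hl := hx.hasLaw_count B hB hb
  rw [← lintegral_map' (f := fun n : ℕ∞ => ENNReal.ofReal c ^ n.toNat) (by fun_prop)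
      hl.aemeasurable,
    hl.map_eq, lintegral_map .of_discrete .of_discrete]
  simp only [ENat.toNat_natCast]
  rw [lintegral_pow_poissonMeasure _ hc, Real.coe_toNNReal _ (by positivity)]

theorem IsPoissonProcess.ae_finite (hx : IsPoissonProcess P lam x)
    (hB : MeasurableSet B) (hb : Bornology.IsBounded B) :
    ∀ᵐ ω ∂P, {n | x n ω ∈ B}.Finite := by
  have hl := hx.hasLaw_count B hB hb
  have h1 : ∀ᵐ k ∂P.map (pointCount x B), k ≠ ⊤ := by
    rw [hl.map_eq, ae_map_iff .of_discrete .of_discrete]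
    exact ae_of_all _ fun n => ENat.natCast_ne_top n
  filter_upwards [ae_of_ae_map hl.aemeasurable h1] with ω hω
  exact encard_ne_top_iff.1 hω

theorem pointCount_eq_zero_iff {Ω : Type*} (x : ℕ → Ω → ℂ) (B : Set ℂ) (ω : Ω) :
    pointCount x B ω = 0 ↔ ∀ n, x n ω ∉ B := by
  rw [pointCount, encard_eq_zero, eq_empty_iff_forall_notMem]
  rfl

theorem IsPoissonProcess.measure_void (hx : IsPoissonProcess P lam x) (hlam : 0 ≤ lam)
    (hB : MeasurableSet B) (hb : Bornology.IsBounded B) :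
    P {ω | ∀ n, x n ω ∉ B} = ENNReal.ofReal (exp (-(lam * volume.real B))) := by
  have hl := hx.hasLaw_count B hB hb
  have h1 : P {ω | pointCount x B ω = 0} = _ :=
    hl.measure_eq (p := fun k => k = 0) (MeasurableSet.of_discrete)
  simp only [pointCount_eq_zero_iff] at h1
  rw [h1, Measure.map_apply .of_discrete .of_discrete]
  have h2 : (Nat.cast : ℕ → ℕ∞) ⁻¹' {k | k = 0} = {0} := by
    ext n; simp
  rw [h2, poissonMeasure_singleton]
  simp [Real.coe_toNNReal _ (mul_nonneg hlam measureReal_nonneg)]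

end Poisson

/-! ### Thinning by activity and beam direction -/

namespace Network

variable {Ω : Type*} [MeasurableSpace Ω] {P : Measure Ω} {N : Network Ω} {lamT lamO ρa : ℝ}

theorem IsRandomNetwork.measure_angle_le (hN : N.IsRandomNetwork P lamT lamO ρa) (n : ℕ) {w : ℂ}
    (hw : w ≠ 0) {θ : ℝ} (hθ' : θ ≤ 2 * π) :
    P {ω | InnerProductGeometry.angle (Complex.exp (N.dir n ω * Complex.I)) w ≤ θ / 2} =
      ENNReal.ofReal (θ / (2 * π)) := by
  have hm : Measurable fun φ : ℝ => InnerProductGeometry.angle (Complex.exp (φ * Complex.I)) w := by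
    unfold InnerProductGeometry.angle
    fun_prop
  rw [(hN.law_dir n).measure_eq
    (p := fun φ => InnerProductGeometry.angle (Complex.exp (φ * Complex.I)) w ≤ θ / 2)
    (hm measurableSet_Iic), cond_apply measurableSet_Ioc, Set.inter_comm, volume_angle_le hw hθ',
    Real.volume_Ioc, show π - -π = 2 * π by ring, ENNReal.ofReal_div_of_pos two_pi_pos, mul_comm]
  rfl

theorem measurableSet_uncovered {B : Set ℂ} (hB : MeasurableSet B) (θ : ℝ) :
    MeasurableSet {p : ((ℕ → ℂ) × (ℕ → Bool)) × (ℕ → ℝ) | ∀ n, ¬ (p.1.2 n = true ∧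
      InnerProductGeometry.angle (Complex.exp (p.2 n * Complex.I)) (0 - p.1.1 n) ≤ θ / 2 ∧
      p.1.1 n ∈ B)} := by
  have hm : ∀ n, Measurable fun p : ((ℕ → ℂ) × (ℕ → Bool)) × (ℕ → ℝ) =>
      InnerProductGeometry.angle (Complex.exp (p.2 n * Complex.I)) (0 - p.1.1 n) := by
    intro n
    unfold InnerProductGeometry.angle
    fun_prop
  have ha : ∀ n, Measurable fun p : ((ℕ → ℂ) × (ℕ → Bool)) × (ℕ → ℝ) => p.1.2 n := by
    intro n; fun_prop
  have ht : ∀ n, Measurable fun p : ((ℕ → ℂ) × (ℕ → Bool)) × (ℕ → ℝ) => p.1.1 n := by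
    intro n; fun_prop
  simp only [ofPred_forall]
  refine MeasurableSet.iInter fun n => MeasurableSet.compl ?_
  exact ((ha n) (measurableSet_singleton true)).inter
    (((hm n) measurableSet_Iic).inter ((ht n) hB))

/-- The positions are frozen; `ω` carries the activities and `ω'` the directions. For fixed
activities, independent directions give a factor `1 - θ / (2π)` per active point of `B` and `1` per
inactive one; the activities are then averaged point by point. -/
theorem IsRandomNetwork.measure_uncovered [IsProbabilityMeasure P]
    (hN : N.IsRandomNetwork P lamT lamO ρa) (hρa : ρa ∈ Icc (0 : ℝ) 1) {t : ℕ → ℂ}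
    {B : Set ℂ} (h0 : (0 : ℂ) ∉ B)
    (hfin : {n | t n ∈ B}.Finite) {θ : ℝ} (hθ : 0 ≤ θ) (hθ' : θ ≤ 2 * π) :
    ∫⁻ ω, P {ω' | ∀ n, ¬ (N.act n ω = true ∧
      InnerProductGeometry.angle (Complex.exp (N.dir n ω' * Complex.I)) (0 - t n) ≤ θ / 2 ∧
      t n ∈ B)} ∂P = ENNReal.ofReal (1 - ρa * θ / (2 * π)) ^ {n | t n ∈ B}.encard.toNat := by
  have hq : θ / (2 * π) ≤ 1 := (div_le_one two_pi_pos).2 hθ'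
  have hq0 : 0 ≤ θ / (2 * π) := div_nonneg hθ two_pi_pos.le
  have hm : ∀ w : ℂ, Measurable
      fun φ : ℝ => InnerProductGeometry.angle (Complex.exp (φ * Complex.I)) w := by
    intro w
    unfold InnerProductGeometry.angle
    fun_prop
  have h1 : ∀ ω, P {ω' | ∀ n, ¬ (N.act n ω = true ∧
      InnerProductGeometry.angle (Complex.exp (N.dir n ω' * Complex.I)) (0 - t n) ≤ θ / 2 ∧
      t n ∈ B)} = ∏ n ∈ hfin.toFinset,
        if N.act n ω = true then ENNReal.ofReal (1 - θ / (2 * π)) else 1 := by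
    intro ω
    have h2 := hN.indep_dir.measure_inter_preimage_eq_mul hfin.toFinset
      (sets := fun n => {φ | ¬ (N.act n ω = true ∧
        InnerProductGeometry.angle (Complex.exp (φ * Complex.I)) (0 - t n) ≤ θ / 2)})
      (fun n _ => ((MeasurableSet.const _).inter ((hm (0 - t n)) measurableSet_Iic)).compl)
    refine Eq.trans (congrArg P ?_) (h2.trans (Finset.prod_congr rfl fun n hn => ?_))
    · ext ω'
      simp only [mem_ofPred_eq, mem_iInter, Finite.mem_toFinset, mem_preimage]
      exact forall_congr' fun n => by tauto
    · have hn' : t n ∈ B := hfin.mem_toFinset.1 hn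
      -- The angle with the zero vector is `π / 2` by convention and does not depend on the
      -- direction, so the origin has to be excluded.
      have hw : 0 - t n ≠ 0 := by
        rw [zero_sub, neg_ne_zero]
        rintro h
        exact h0 (h ▸ hn')
      by_cases ha : N.act n ω = true
      · simp only [ha, true_and, if_true]
        have hc := prob_compl_eq_one_sub (μ := P) (s := {ω' | InnerProductGeometry.angle
          (Complex.exp (N.dir n ω' * Complex.I)) (0 - t n) ≤ θ / 2})
          (((hm (0 - t n)).comp (hN.measurable_dir n)) measurableSet_Iic)
        rw [hN.measure_angle_le n hw hθ'] at hc
        rw [ENNReal.ofReal_sub _ hq0, ENNReal.ofReal_one]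
        exact hc
      · simp [ha]
  simp_rw [h1]
  have hind := hN.indep_act.comp
    (fun _ b => if b = true then ENNReal.ofReal (1 - θ / (2 * π)) else 1)
    (fun _ => measurable_from_top)
  have hfm : Measurable fun b : Bool => if b = true then ENNReal.ofReal (1 - θ / (2 * π)) else 1 :=
    measurable_from_top
  have h3 := lintegral_prod_eq_prod_lintegral_of_indepFun hfin.toFinset _ hind
    (fun n => hfm.comp (hN.measurable_act n))
  refine h3.trans ?_
  -- The mean factor is `ρa * (1 - θ / (2π)) + (1 - ρa)`.
  have h4 : ∀ n, ∫⁻ ω, ((fun b : Bool => if b = true then ENNReal.ofReal (1 - θ / (2 * π)) else 1) ∘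
      N.act n) ω ∂P = ENNReal.ofReal (1 - ρa * θ / (2 * π)) := by
    intro n
    have hA : MeasurableSet {ω | N.act n ω = true} :=
      (hN.measurable_act n) (measurableSet_singleton true)
    have hP : P {ω | N.act n ω = true} = ENNReal.ofReal ρa := by
      rw [← hN.prob_act n, ofReal_measureReal]
    have hP' : P {ω | N.act n ω = true}ᶜ = ENNReal.ofReal (1 - ρa) := by
      rw [prob_compl_eq_one_sub hA, hP, ENNReal.ofReal_sub _ hρa.1, ENNReal.ofReal_one]
    rw [← lintegral_add_compl _ hA,
      setLIntegral_congr_fun (g := fun _ => ENNReal.ofReal (1 - θ / (2 * π))) hA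
      (fun ω hω => by simpa using fun h => absurd hω (by simp [h])),
      setLIntegral_congr_fun (g := fun _ => 1) hA.compl
      (fun ω hω => by simpa using fun h => absurd h hω), setLIntegral_const, setLIntegral_const,
      hP, hP', one_mul, ← ENNReal.ofReal_mul (by linarith), ← ENNReal.ofReal_add
        (mul_nonneg (by linarith) hρa.1) (by linarith [hρa.2])]
    congr 1
    ring
  rw [Finset.prod_congr rfl fun n _ => h4 n, Finset.prod_const, hfin.encard_eq_coe_toFinset_card,
    ENat.toNat_natCast]

/-- The void probability of the thinned process of those transmitters that are active and have the
origin in their main lobe. -/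
theorem IsRandomNetwork.measure_void_thinned [IsProbabilityMeasure P]
    (hN : N.IsRandomNetwork P lamT lamO ρa) (hlamT : 0 ≤ lamT) (hρa : ρa ∈ Icc (0 : ℝ) 1)
    {B : Set ℂ} (hB : MeasurableSet B) (hb : Bornology.IsBounded B) (h0 : (0 : ℂ) ∉ B)
    {θ : ℝ} (hθ : 0 ≤ θ) (hθ' : θ ≤ 2 * π) :
    P {ω | ∀ n, ¬ (N.act n ω = true ∧
      InnerProductGeometry.angle (Complex.exp (N.dir n ω * Complex.I)) (0 - N.tx n ω) ≤ θ / 2 ∧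
      N.tx n ω ∈ B)} =
      ENNReal.ofReal (exp (-(ρa * lamT * θ / (2 * π) * volume.real B))) := by
  have hT : Measurable fun ω n => N.tx n ω := measurable_pi_lambda _ hN.poisson_tx.measurable
  have hA : Measurable fun ω n => N.act n ω := measurable_pi_lambda _ hN.measurable_act
  have hD : Measurable fun ω n => N.dir n ω := measurable_pi_lambda _ hN.measurable_dir
  set E := {p : ((ℕ → ℂ) × (ℕ → Bool)) × (ℕ → ℝ) | ∀ n, ¬ (p.1.2 n = true ∧
      InnerProductGeometry.angle (Complex.exp (p.2 n * Complex.I)) (0 - p.1.1 n) ≤ θ / 2 ∧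
      p.1.1 n ∈ B)} with hE
  have hEm : MeasurableSet E := measurableSet_uncovered hB θ
  set F : ((ℕ → ℂ) × (ℕ → Bool)) × (ℕ → ℝ) → ENNReal := E.indicator 1
  have hf : Measurable F := measurable_one.indicator hEm
  have e1 : ∀ p, ∫⁻ ω', F (p, fun n => N.dir n ω') ∂P =
      P {ω' | (p, fun n => N.dir n ω') ∈ E} := by
    intro p
    have hm : MeasurableSet {ω' | (p, fun n => N.dir n ω') ∈ E} :=
      (measurable_const.prodMk hD) hEm
    rw [← lintegral_indicator_one hm]
    rfl
  have e0 : P {ω | ((fun n => N.tx n ω, fun n => N.act n ω), fun n => N.dir n ω) ∈ E} =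
      ∫⁻ ω, F
        ((fun n => N.tx n ω, fun n => N.act n ω), fun n => N.dir n ω) ∂P :=
    (lintegral_indicator_one (((hT.prodMk hA).prodMk hD) hEm)).symm
  refine e0.trans ?_
  -- Directions are split off first, activities from positions next, matching the two independence
  -- assumptions.
  rw [lintegral_comp_prodMk_of_indepFun (hT.prodMk hA) hD hN.indep_tx_act_dir hf]
  have hf' : Measurable fun p => ∫⁻ ω', F (p, fun n => N.dir n ω') ∂P :=
    Measurable.lintegral_prod_right' (f := fun q : ((ℕ → ℂ) × (ℕ → Bool)) × Ω =>
      F (q.1, fun n => N.dir n q.2))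
      (hf.comp (measurable_fst.prodMk (hD.comp measurable_snd)))
  rw [lintegral_comp_prodMk_of_indepFun hT hA hN.indep_tx_act hf']
  have hc : 0 ≤ 1 - ρa * θ / (2 * π) := by
    rw [sub_nonneg, div_le_one two_pi_pos]
    nlinarith [hρa.1, hρa.2]
  have h1 : ∀ᵐ ω ∂P, ∫⁻ ω', ∫⁻ ω'', F
      (((fun n => N.tx n ω), (fun n => N.act n ω')), fun n => N.dir n ω'') ∂P ∂P =
      ENNReal.ofReal (1 - ρa * θ / (2 * π)) ^ (pointCount N.tx B ω).toNat := by
    filter_upwards [hN.poisson_tx.ae_finite hB hb] with ω hω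
    simp_rw [e1]
    exact hN.measure_uncovered hρa h0 hω hθ hθ'
  rw [lintegral_congr_ae h1, hN.poisson_tx.lintegral_pow_pointCount hlamT hB hb hc]
  congr 2
  ring

end Network

/-! ### Truncated exponential moment -/

/-- The truncated exponential moment of a random variable with values in `[0, d]` and tail
`exp (-μ x ^ 2)` below `d`. -/
theorem setLIntegral_exp_of_tail {Ω : Type*} [MeasurableSpace Ω] {P : Measure Ω}
    [IsProbabilityMeasure P] {Y : Ω → ℝ} (hY : Measurable Y) {μ ν d l : ℝ} (hμ : 0 < μ)
    (hν : 0 ≤ ν) (h0 : ∀ ω, 0 ≤ Y ω) (hd : ∀ ω, Y ω ≤ d)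
    (htail : ∀ x, 0 ≤ x → x ≤ d → P {ω | x ≤ Y ω} = ENNReal.ofReal (exp (-(μ * x ^ 2))))
    (hl : 0 ≤ l) (hld : l ≤ d) :
    ∫⁻ ω in {ω | l ≤ Y ω}, ENNReal.ofReal (exp (-(ν * Y ω ^ 2))) ∂P =
      ENNReal.ofReal (exp (-((μ + ν) * l ^ 2)) -
        ν / (μ + ν) * (exp (-((μ + ν) * l ^ 2)) - exp (-((μ + ν) * d ^ 2)))) := by
  have hS : 0 < μ + ν := by linarith
  have hd0 : 0 ≤ d := hl.trans hld
  set Q := P.restrict {ω | l ≤ Y ω} with hQ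
  have hder : ∀ c t : ℝ, HasDerivAt (fun t => -exp (-(c * t ^ 2)))
      (2 * c * t * exp (-(c * t ^ 2))) t := by
    intro c t
    have := (((hasDerivAt_pow 2 t).const_mul c).fun_neg.exp).fun_neg
    refine this.congr_deriv ?_
    push_cast
    ring
  have hint : ∀ c a b : ℝ, ∫ t in a..b, 2 * c * t * exp (-(c * t ^ 2)) =
      exp (-(c * a ^ 2)) - exp (-(c * b ^ 2)) := by
    intro c a b
    rw [intervalIntegral.integral_eq_sub_of_hasDerivAt (fun t _ => hder c t)
      (by apply Continuous.intervalIntegrable; fun_prop)]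
    ring
  -- Layer-cake formula: the integral of `g` from `0` to `Y` is `1 - exp (-ν Y ^ 2)`, so only the
  -- tail of `Y` under `Q` is needed.
  have hlayer := lintegral_comp_eq_lintegral_meas_le_mul Q (f := Y)
    (g := fun t => 2 * ν * t * exp (-(ν * t ^ 2))) (ae_of_all _ h0) hY.aemeasurable
    (fun t _ => by apply Continuous.intervalIntegrable; fun_prop)
    ((ae_restrict_iff' measurableSet_Ioi).2 (ae_of_all _ fun t ht => by
      have : 0 < t := ht
      positivity))
  simp only [hint] at hlayer
  have hQt : ∀ t, 0 < t → Q {ω | t ≤ Y ω} * ENNReal.ofReal (2 * ν * t * exp (-(ν * t ^ 2))) =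
      (Ioc 0 d).indicator (fun t => ENNReal.ofReal
        (exp (-(μ * max t l ^ 2)) * (2 * ν * t * exp (-(ν * t ^ 2))))) t := by
    intro t ht
    have e : {ω | t ≤ Y ω} ∩ {ω | l ≤ Y ω} = {ω | max t l ≤ Y ω} := by
      ext ω; simp
    rw [hQ, Measure.restrict_apply (measurableSet_le measurable_const hY), e]
    by_cases htd : t ≤ d
    · rw [indicator_of_mem (mem_Ioc.2 ⟨ht, htd⟩), htail _ (le_max_of_le_right hl) (max_le htd hld),
        ← ENNReal.ofReal_mul (exp_pos _).le]
    · rw [indicator_of_notMem (fun h => htd (mem_Ioc.1 h).2)]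
      have : {ω | max t l ≤ Y ω} = ∅ := by
        ext ω
        simp only [mem_ofPred_eq, mem_empty_iff_false, iff_false, not_le]
        exact lt_max_of_lt_left ((hd ω).trans_lt (not_le.1 htd))
      rw [this]
      simp
  rw [setLIntegral_congr_fun measurableSet_Ioi hQt, lintegral_indicator measurableSet_Ioc,
    Measure.restrict_restrict measurableSet_Ioc,
    inter_eq_self_of_subset_left (Ioc_subset_Ioi_self)] at hlayer
  have hcont : Continuous fun t : ℝ =>
      exp (-(μ * max t l ^ 2)) * (2 * ν * t * exp (-(ν * t ^ 2))) := by fun_prop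
  rw [← ofReal_integral_eq_lintegral_ofReal
    ((hcont.intervalIntegrable 0 d).1)
    ((ae_restrict_iff' measurableSet_Ioc).2 (ae_of_all _ fun t ht => by
      have : 0 < t := ht.1
      -- The integral is split at `l`: below, the tail factor is constant; above, the two
      -- exponentials merge into one with rate `μ + ν`.
      positivity)), ← intervalIntegral.integral_of_le hd0,
    ← intervalIntegral.integral_add_adjacent_intervals (hcont.intervalIntegrable 0 l)
      (hcont.intervalIntegrable l d)] at hlayer
  have hI1 : ∫ t in (0 : ℝ)..l, exp (-(μ * max t l ^ 2)) * (2 * ν * t * exp (-(ν * t ^ 2))) =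
      exp (-(μ * l ^ 2)) * (1 - exp (-(ν * l ^ 2))) := by
    rw [intervalIntegral.integral_congr
      (g := fun t => exp (-(μ * l ^ 2)) * (2 * ν * t * exp (-(ν * t ^ 2))))]
    · rw [intervalIntegral.integral_const_mul, hint]
      simp
    · intro t ht
      rw [uIcc_of_le hl] at ht
      simp only [max_eq_right ht.2]
  have hI2 : ∫ t in l..d, exp (-(μ * max t l ^ 2)) * (2 * ν * t * exp (-(ν * t ^ 2))) =
      ν / (μ + ν) * (exp (-((μ + ν) * l ^ 2)) - exp (-((μ + ν) * d ^ 2))) := by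
    rw [intervalIntegral.integral_congr
      (g := fun t => ν / (μ + ν) * (2 * (μ + ν) * t * exp (-((μ + ν) * t ^ 2))))]
    · rw [intervalIntegral.integral_const_mul, hint]
    · intro t ht
      rw [uIcc_of_le hld] at ht
      simp only [max_eq_left ht.1]
      rw [show -((μ + ν) * t ^ 2) = -(μ * t ^ 2) + -(ν * t ^ 2) by ring, Real.exp_add]
      field_simp
  rw [hI1, hI2] at hlayer
  have hle : ∀ ω, exp (-(ν * Y ω ^ 2)) ≤ 1 := fun ω =>
    Real.exp_le_one_iff.2 (by have := h0 ω; simp only [Left.neg_nonpos_iff]; positivity)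
  -- The layer-cake formula yields the complementary moment; the two add up to the mass `P (l ≤ Y)`
  -- of `Q`.
  have hsum : ∫⁻ ω, ENNReal.ofReal (exp (-(ν * Y ω ^ 2))) ∂Q +
      ∫⁻ ω, ENNReal.ofReal (exp (-(ν * 0 ^ 2)) - exp (-(ν * Y ω ^ 2))) ∂Q =
      ENNReal.ofReal (exp (-(μ * l ^ 2))) := by
    rw [← lintegral_add_left (by fun_prop)]
    have : ∀ ω, ENNReal.ofReal (exp (-(ν * Y ω ^ 2))) +
        ENNReal.ofReal (exp (-(ν * 0 ^ 2)) - exp (-(ν * Y ω ^ 2))) = 1 := by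
      intro ω
      have h1 : exp (-(ν * 0 ^ 2)) = 1 := by simp
      rw [h1, ← ENNReal.ofReal_add (Real.exp_pos _).le (sub_nonneg.2 (hle ω))]
      simp
    simp_rw [this]
    rw [lintegral_one, hQ, Measure.restrict_apply_univ, htail l hl hld]
  rw [hlayer] at hsum
  have hnn : 0 ≤ exp (-(μ * l ^ 2)) * (1 - exp (-(ν * l ^ 2))) +
      ν / (μ + ν) * (exp (-((μ + ν) * l ^ 2)) - exp (-((μ + ν) * d ^ 2))) := by
    have h1 : exp (-(ν * l ^ 2)) ≤ 1 :=
      Real.exp_le_one_iff.2 (by simp only [Left.neg_nonpos_iff]; positivity)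
    have h2 : exp (-((μ + ν) * d ^ 2)) ≤ exp (-((μ + ν) * l ^ 2)) := by
      rw [Real.exp_le_exp]
      gcongr
    have := sub_nonneg.2 h1
    have := sub_nonneg.2 h2
    positivity
  rw [ENNReal.eq_sub_of_add_eq ENNReal.ofReal_ne_top hsum, ← ENNReal.ofReal_sub _ hnn]
  congr 1
  rw [show -((μ + ν) * l ^ 2) = -(μ * l ^ 2) + -(ν * l ^ 2) by ring, Real.exp_add]
  ring

/-! ### Clearance of a sector: law and independence -/

/-- The distance up to which the view from the origin into `C` is clear of the points `o 0, o 1, …`,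
truncated at `d`. -/
noncomputable def clearance (C : Set ℂ) (d : ℝ) (o : ℕ → ℂ) : ℝ :=
  ⨅ m, C.indicator (fun z => min ‖z‖ d - d) (o m) + d

section Clearance

variable {C : Set ℂ} {d : ℝ} {o : ℕ → ℂ}

theorem clearance_term_nonneg (hd : 0 ≤ d) (z : ℂ) :
    0 ≤ C.indicator (fun z => min ‖z‖ d - d) z + d := by
  by_cases h : z ∈ C <;> simp [h, hd]

theorem bddBelow_clearance (hd : 0 ≤ d) (o : ℕ → ℂ) :
    BddBelow (range fun m => C.indicator (fun z => min ‖z‖ d - d) (o m) + d) :=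
  ⟨0, by rintro _ ⟨m, rfl⟩; exact clearance_term_nonneg hd _⟩

theorem clearance_nonneg (hd : 0 ≤ d) : 0 ≤ clearance C d o :=
  le_ciInf fun _ => clearance_term_nonneg hd _

theorem clearance_le (hd : 0 ≤ d) : clearance C d o ≤ d := by
  refine (ciInf_le (bddBelow_clearance hd o) 0).trans ?_
  by_cases h : o 0 ∈ C <;> simp [h]

/-- A term of the infimum is `min ‖o m‖ d` if `o m ∈ C` and `d` otherwise. Up to the truncation
level, tail events of the clearance are therefore void events. -/
theorem le_clearance_iff (hd : 0 ≤ d) {x : ℝ} (hx : x ≤ d) :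
    x ≤ clearance C d o ↔ ∀ m, o m ∉ C ∩ {z | ‖z‖ < x} := by
  rw [clearance, le_ciInf_iff (bddBelow_clearance hd o)]
  refine forall_congr' fun m => ?_
  by_cases h : o m ∈ C <;> simp [h, hx]

theorem measurable_clearance (hC : MeasurableSet C) : Measurable (clearance C d) := by
  refine Measurable.iInf fun m => ?_
  have h : Measurable (C.indicator fun z : ℂ => min ‖z‖ d - d) :=
    Measurable.indicator (by fun_prop) hC
  exact (h.comp (measurable_pi_apply m)).add_const d

theorem lt_norm_of_lt_clearance (hd : 0 ≤ d) {z : ℂ} (hz : ‖z‖ < clearance C d o) {m : ℕ}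
    (hm : o m ∈ C) : ‖z‖ < ‖o m‖ := by
  have h := (le_clearance_iff (C := C) (o := o) hd (clearance_le hd)).1 le_rfl m
  simp only [mem_inter_iff, hm, true_and, mem_ofPred_eq, not_lt] at h
  exact hz.trans_le h

theorem le_clearance_of_forall_lt (hd : 0 ≤ d) {x : ℝ} (hx : x ≤ d)
    (h : ∀ m, o m ∈ C → x < ‖o m‖) : x ≤ clearance C d o :=
  (le_clearance_iff hd hx).2 fun m hm => lt_asymm hm.2 (h m hm.1)

end Clearance

theorem isBounded_inter_norm_lt (C : Set ℂ) (x : ℝ) : Bornology.IsBounded (C ∩ {z | ‖z‖ < x}) :=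
  (Metric.isBounded_ball (x := (0 : ℂ)) (r := x)).subset fun z hz => by simpa using hz.2

theorem isBounded_inter_norm_le (C : Set ℂ) (x : ℝ) : Bornology.IsBounded (C ∩ {z | ‖z‖ ≤ x}) :=
  (Metric.isBounded_closedBall (x := (0 : ℂ)) (r := x)).subset fun z hz => by simpa using hz.2

theorem measurableSet_inter_norm_lt {C : Set ℂ} (hC : MeasurableSet C) (x : ℝ) :
    MeasurableSet (C ∩ {z | ‖z‖ < x}) :=
  hC.inter (measurable_norm measurableSet_Iio)

theorem measurableSet_inter_norm_le {C : Set ℂ} (hC : MeasurableSet C) (x : ℝ) :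
    MeasurableSet (C ∩ {z | ‖z‖ ≤ x}) :=
  hC.inter (measurable_norm measurableSet_Iic)

theorem le_clearance_eq_pointCount_preimage {Ω : Type*} {x : ℕ → Ω → ℂ} {d : ℝ} (hd : 0 ≤ d)
    {C : Set ℂ} {y : ℝ} (hy : y ≤ d) :
    {ω | y ≤ clearance C d (fun m => x m ω)} = pointCount x (C ∩ {z | ‖z‖ < y}) ⁻¹' {0} := by
  ext ω
  rw [mem_ofPred_eq, le_clearance_iff hd hy, mem_preimage, mem_singleton_iff,
    pointCount_eq_zero_iff]

section Obstacles

variable {Ω : Type*} [MeasurableSpace Ω] {P : Measure Ω} {lam d : ℝ} {x : ℕ → Ω → ℂ}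

/-- The half-lines `Ici y` form a π-system generating the Borel sets, so it suffices to treat tail
events. These are void events of disjoint bounded sets, whose counts are independent. -/
theorem IsPoissonProcess.iIndepFun_clearance [IsProbabilityMeasure P]
    (hx : IsPoissonProcess P lam x) (hd : 0 ≤ d) {k : ℕ} {C : Fin k → Set ℂ}
    (hC : ∀ i, MeasurableSet (C i)) (hdisj : Pairwise (Function.onFun Disjoint C)) :
    iIndepFun (fun i ω => clearance (C i) d (fun m => x m ω)) P := by
  have hm : ∀ i, Measurable fun ω => clearance (C i) d (fun m => x m ω) := fun i =>
    (measurable_clearance (hC i)).comp (measurable_pi_lambda _ hx.measurable)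
  refine (iIndepFun_iff_iIndep _ _ _).2 (iIndepSets.iIndep (fun i => (hm i).comap_le)
    (fun i => {s | ∃ t ∈ range Ici, (fun ω => clearance (C i) d (fun m => x m ω)) ⁻¹' t = s})
    (fun i => isPiSystem_Ici.comap _) (fun i => ?_) ?_)
  · rw [BorelSpace.measurable_eq (α := ℝ), borel_eq_generateFrom_Ici,
      MeasurableSpace.comap_generateFrom]
    rfl
  · rw [iIndepSets_iff]
    intro s f hf
    have hf' : ∀ i ∈ s, ∃ y, f i = {ω | y ≤ clearance (C i) d (fun m => x m ω)} := by
      intro i hi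
      obtain ⟨_, ⟨y, rfl⟩, h⟩ := hf i hi
      exact ⟨y, h.symm⟩
    choose! y hy using hf'
    rw [iInter₂_congr hy, Finset.prod_congr rfl fun i hi => by rw [hy i hi]]
    by_cases hyd : ∀ i ∈ s, y i ≤ d
    · have hind := hx.indep_count k (fun i => C i ∩ {z | ‖z‖ < y i})
        (fun i => measurableSet_inter_norm_lt (hC i) _) (fun i => isBounded_inter_norm_lt _ _)
        (fun i j hij => (hdisj hij).mono inter_subset_left inter_subset_left)
      have h := hind.measure_inter_preimage_eq_mul s (sets := fun _ => {0})
        (fun _ _ => .of_discrete)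
      rw [iInter₂_congr fun i hi => le_clearance_eq_pointCount_preimage hd (hyd i hi), h]
      exact Finset.prod_congr rfl fun i hi => by
        rw [le_clearance_eq_pointCount_preimage hd (hyd i hi)]
    -- A threshold above `d` is never reached, so both sides vanish.
    · push Not at hyd
      obtain ⟨i, hi, hid⟩ := hyd
      have he : {ω | y i ≤ clearance (C i) d (fun m => x m ω)} = ∅ := by
        ext ω
        simpa using (clearance_le hd).trans_lt hid
      rw [Finset.prod_eq_zero hi (by rw [he, measure_empty])]
      exact measure_mono_null (iInter₂_subset i hi) (by rw [he, measure_empty])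

theorem IsPoissonProcess.measure_le_clearance (hx : IsPoissonProcess P lam x) (hlam : 0 ≤ lam)
    (hd : 0 ≤ d) {a b : ℝ} (hab : a ≤ b) (hb : b ≤ a + 2 * π) {y : ℝ} (hy0 : 0 ≤ y) (hy : y ≤ d) :
    P {ω | y ≤ clearance (sector a b) d (fun m => x m ω)} =
      ENNReal.ofReal (exp (-(lam * ((b - a) / 2) * y ^ 2))) := by
  simp_rw [le_clearance_iff hd hy]
  rw [hx.measure_void hlam (measurableSet_inter_norm_lt (measurableSet_sector hb) _)
    (isBounded_inter_norm_lt _ _), measureReal_def, volume_sector_inter_lt hb hy0,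
    ENNReal.toReal_ofReal (by have := sub_nonneg.2 hab; positivity)]
  congr 3
  ring

end Obstacles

/-! ### The visible region and its area -/

/-- The points of the main lobe up to distance `d` that are in line of sight when the obstacles are
at `o 0, o 1, …`. -/
def visibleRegion (ψ θ θc d : ℝ) (o : ℕ → ℂ) : Set ℂ :=
  {z | z ∈ sector ψ (ψ + θ) ∧ ‖z‖ ≤ d ∧ ∀ i < ⌈θ / θc⌉₊, z ∈ cohSector ψ θc i →
    ∀ m, o m ∈ cohSector ψ θc i → ‖z‖ < ‖o m‖}

section Geometry

variable {ψ θ θc d : ℝ}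

theorem zero_notMem_sector (a b : ℝ) : (0 : ℂ) ∉ sector a b := by
  rintro ⟨r, hr, φ, -, h⟩
  have := congrArg norm h
  rw [norm_zero, norm_mul, Complex.norm_exp_ofReal_mul_I, Complex.norm_real, mul_one] at this
  exact hr.ne' (norm_eq_zero.1 this.symm)

theorem isBounded_visibleRegion (o : ℕ → ℂ) :
    Bornology.IsBounded (visibleRegion ψ θ θc d o) :=
  (isBounded_inter_norm_le (sector ψ (ψ + θ)) d).subset fun _ hz => ⟨hz.1, hz.2.1⟩

theorem measurableSet_cohSector {k : ℕ} (hθc : 0 < θc) (hk : k * θc = θ) (hθ : θ ≤ 2 * π) {i : ℕ}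
    (hi : i < k) : MeasurableSet (cohSector ψ θc i) := by
  refine measurableSet_sector ?_
  have h1 : (1 : ℝ) ≤ k := by exact_mod_cast (Nat.succ_le_of_lt (i.zero_le.trans_lt hi))
  nlinarith

/-- Joint measurability in the point and the obstacles is needed because transmitters, too, are
random points tested for line of sight. -/
theorem measurableSet_lineOfSight {k : ℕ} (hθc : 0 < θc) (hk : k * θc = θ) (hθ : θ ≤ 2 * π)
    (hK : ⌈θ / θc⌉₊ = k) :
    MeasurableSet {q : ℂ × (ℕ → ℂ) | ∀ i < ⌈θ / θc⌉₊, q.1 ∈ cohSector ψ θc i →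
      ∀ m, q.2 m ∈ cohSector ψ θc i → ‖q.1‖ < ‖q.2 m‖} := by
  rw [hK]
  simp only [ofPred_forall]
  refine MeasurableSet.iInter fun i => MeasurableSet.iInter fun hi => ?_
  have hC := measurableSet_cohSector (ψ := ψ) hθc hk hθ hi
  have h1 : Measurable fun q : ℂ × (ℕ → ℂ) => q.1 ∈ cohSector ψ θc i :=
    measurableSet_setOfPred.1 (measurable_fst hC)
  have h2 : ∀ m, Measurable fun q : ℂ × (ℕ → ℂ) => q.2 m ∈ cohSector ψ θc i := fun m =>
    measurableSet_setOfPred.1 (((measurable_pi_apply m).comp measurable_snd) hC)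
  have h3 : ∀ m, Measurable fun q : ℂ × (ℕ → ℂ) => ‖q.1‖ < ‖q.2 m‖ := fun m =>
    measurableSet_setOfPred.1 (measurableSet_lt (by fun_prop) (by fun_prop))
  have h4 := measurableSet_setOfPred.2
    (h1.imp (Measurable.forall fun m => (h2 m).imp (h3 m)))
  simpa only [← ofPred_forall] using h4

theorem measurableSet_visibleRegion_prod {k : ℕ} (hθc : 0 < θc) (hk : k * θc = θ)
    (hθ : θ ≤ 2 * π) (hK : ⌈θ / θc⌉₊ = k) :
    MeasurableSet {q : ℂ × (ℕ → ℂ) | q.1 ∈ visibleRegion ψ θ θc d q.2} :=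
  (measurable_fst (measurableSet_sector (by linarith))).inter
    ((measurable_fst.norm measurableSet_Iic).inter (measurableSet_lineOfSight hθc hk hθ hK))

theorem measurableSet_visibleRegion {k : ℕ} (hθc : 0 < θc) (hk : k * θc = θ)
    (hθ : θ ≤ 2 * π) (hK : ⌈θ / θc⌉₊ = k) (o : ℕ → ℂ) :
    MeasurableSet (visibleRegion ψ θ θc d o) :=
  (measurable_id.prodMk measurable_const) (measurableSet_visibleRegion_prod hθc hk hθ hK)

/-- The visible part of a coherence sector lies between the open and the closed circle sector whose
radius is the clearance, and these have equal area. -/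
theorem volume_visibleRegion_inter {k : ℕ} (hθc : 0 < θc) (hk : k * θc = θ) (hθ : θ ≤ 2 * π)
    (hK : ⌈θ / θc⌉₊ = k) (hd : 0 ≤ d) (o : ℕ → ℂ) {i : ℕ} (hi : i < k) :
    volume (visibleRegion ψ θ θc d o ∩ cohSector ψ θc i) =
      ENNReal.ofReal (θc / 2 * clearance (cohSector ψ θc i) d o ^ 2) := by
  set y := clearance (cohSector ψ θc i) d o with hy
  have hy0 : 0 ≤ y := clearance_nonneg hd
  have hb : ψ + (i + 1) * θc ≤ ψ + i * θc + 2 * π := by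
    have h1 : (1 : ℝ) ≤ k := by exact_mod_cast (Nat.succ_le_of_lt (i.zero_le.trans_lt hi))
    nlinarith
  have e : (ψ + ((i : ℝ) + 1) * θc - (ψ + i * θc)) * y ^ 2 / 2 = θc / 2 * y ^ 2 := by ring
  apply le_antisymm
  · rw [← e, ← volume_sector_inter_le hb hy0]
    refine measure_mono fun z hz => ⟨hz.2, ?_⟩
    exact le_clearance_of_forall_lt hd hz.1.2.1 (hz.1.2.2 i (hK ▸ hi) hz.2)
  · rw [← e, ← volume_sector_inter_lt hb hy0]
    refine measure_mono ?_
    rintro z ⟨hz, hzy⟩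
    have hz' : z ∈ cohSector ψ θc i := hz
    refine ⟨⟨(mem_beam_iff_exists hθc hk hθ z).2 ⟨i, hi, hz⟩,
      (le_of_lt hzy).trans (clearance_le hd), fun j hj hzj m hm => ?_⟩, hz⟩
    have hij : j = i := by
      by_contra hne
      exact Set.disjoint_left.1 (disjoint_cohSector hθc hk hθ (hK ▸ hj) hi hne) hzj hz
    subst hij
    exact lt_norm_of_lt_clearance hd hzy hm

theorem volume_real_visibleRegion {k : ℕ} (hθc : 0 < θc) (hk : k * θc = θ) (hθ : θ ≤ 2 * π)
    (hK : ⌈θ / θc⌉₊ = k) (hd : 0 ≤ d) (o : ℕ → ℂ) :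
    volume.real (visibleRegion ψ θ θc d o) =
      ∑ i : Fin k, θc / 2 * clearance (cohSector ψ θc i) d o ^ 2 := by
  have hm : MeasurableSet (visibleRegion ψ θ θc d o) := measurableSet_visibleRegion hθc hk hθ hK o
  have hU : visibleRegion ψ θ θc d o =
      ⋃ i : Fin k, visibleRegion ψ θ θc d o ∩ cohSector ψ θc i := by
    rw [← inter_iUnion, eq_comm, inter_eq_left]
    intro z hz
    obtain ⟨i, hi, h⟩ := (mem_beam_iff_exists hθc hk hθ z).1 hz.1
    exact mem_iUnion.2 ⟨⟨i, hi⟩, h⟩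
  rw [measureReal_def, hU, measure_iUnion, tsum_fintype]
  · rw [Finset.sum_congr rfl fun i _ => volume_visibleRegion_inter hθc hk hθ hK hd o i.2,
      ← ENNReal.ofReal_sum_of_nonneg fun i _ => by positivity,
      ENNReal.toReal_ofReal (Finset.sum_nonneg fun i _ => by positivity)]
  · intro i j hij
    exact (disjoint_cohSector hθc hk hθ i.2 j.2 (fun h => hij (Fin.ext h))).mono
      inter_subset_right inter_subset_right
  · exact fun i => hm.inter (measurableSet_cohSector hθc hk hθ i.2)

end Geometry

/-! ### Conditioning on the obstacles -/

namespace Network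

variable {Ω : Type*} {N : Network Ω} {ψ θ θc d : ℝ} {k : ℕ}

/-- Coherence sectors are disjoint, so only the one containing `z` matters. -/
theorem mem_established_iff (hθc : 0 < θc) (hk : k * θc = θ) (hθ : θ ≤ 2 * π)
    (hK : ⌈θ / θc⌉₊ = k) {j : ℕ} (hj : j < k) {z : ℂ} (hz : z ∈ cohSector ψ θc j) (ω : Ω) :
    ω ∈ N.established ψ θ θc z ↔ ∀ m, N.obs m ω ∉ cohSector ψ θc j ∩ {w | ‖w‖ ≤ ‖z‖} := by
  simp only [established, LoS, mem_ofPred_eq, mem_inter_iff, not_and, not_le]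
  constructor
  · exact fun h => h j (hK ▸ hj) hz
  · intro h i hi hzi
    have hij : i = j := by
      by_contra hne
      exact Set.disjoint_left.1 (disjoint_cohSector hθc hk hθ (hK ▸ hi) hj hne) hzi hz
    exact hij ▸ h

theorem mem_compl_collision_iff (ω : Ω) :
    ω ∈ (N.collision ψ θ θc d)ᶜ ↔ ∀ n, ¬ (N.act n ω = true ∧
      InnerProductGeometry.angle (Complex.exp (N.dir n ω * Complex.I)) (0 - N.tx n ω) ≤ θ / 2 ∧
      N.tx n ω ∈ visibleRegion ψ θ θc d (fun m => N.obs m ω)) := by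
  simp only [collision, mem_compl_iff, mem_ofPred_eq, not_exists]
  rfl

variable [MeasurableSpace Ω] {P : Measure Ω} {lamT lamO ρa : ℝ}

theorem IsRandomNetwork.measure_established (hN : N.IsRandomNetwork P lamT lamO ρa)
    (hlamO : 0 ≤ lamO) (hθc : 0 < θc) (hk : k * θc = θ) (hθ : θ ≤ 2 * π)
    (hK : ⌈θ / θc⌉₊ = k) {j : ℕ} (hj : j < k) {z : ℂ} (hz : z ∈ cohSector ψ θc j) :
    P (N.established ψ θ θc z) = ENNReal.ofReal (exp (-(lamO * (θc / 2) * ‖z‖ ^ 2))) := by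
  have hb : ψ + (j + 1) * θc ≤ ψ + j * θc + 2 * π := by
    have h1 : (1 : ℝ) ≤ k := by exact_mod_cast (Nat.succ_le_of_lt (j.zero_le.trans_lt hj))
    nlinarith
  have e : N.established ψ θ θc z =
      {ω | ∀ m, N.obs m ω ∉ cohSector ψ θc j ∩ {w | ‖w‖ ≤ ‖z‖}} :=
    Set.ext (mem_established_iff hθc hk hθ hK hj hz)
  rw [e, hN.poisson_obs.measure_void hlamO
    (measurableSet_inter_norm_le (measurableSet_cohSector hθc hk hθ hj) _)
    (isBounded_inter_norm_le _ _), measureReal_def, cohSector,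
    volume_sector_inter_le hb (norm_nonneg z), ENNReal.toReal_ofReal (by ring_nf; positivity)]
  congr 3
  ring

theorem IsRandomNetwork.measure_le_clearance_cohSector (hN : N.IsRandomNetwork P lamT lamO ρa)
    (hlamO : 0 ≤ lamO) (hd : 0 ≤ d) (hθc : 0 < θc) (hk : k * θc = θ) (hθ : θ ≤ 2 * π)
    {i : ℕ} (hi : i < k) {y : ℝ} (hy0 : 0 ≤ y) (hy : y ≤ d) :
    P {ω | y ≤ clearance (cohSector ψ θc i) d (fun m => N.obs m ω)} =
      ENNReal.ofReal (exp (-(lamO * (θc / 2) * y ^ 2))) := by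
  have h1 : (1 : ℝ) ≤ k := by exact_mod_cast (Nat.succ_le_of_lt (i.zero_le.trans_lt hi))
  rw [cohSector, hN.poisson_obs.measure_le_clearance hlamO hd (by nlinarith) (by nlinarith) hy0 hy]
  congr 5
  ring

theorem IsRandomNetwork.measurableSet_established (hN : N.IsRandomNetwork P lamT lamO ρa)
    (hθc : 0 < θc) (hk : k * θc = θ) (hθ : θ ≤ 2 * π) (hK : ⌈θ / θc⌉₊ = k) (z : ℂ) :
    MeasurableSet (N.established ψ θ θc z) :=
  (measurable_const.prodMk (measurable_pi_lambda _ hN.poisson_obs.measurable))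
    (measurableSet_lineOfSight hθc hk hθ hK)

/-- The events differ only when an obstacle of the sector is at distance exactly `‖z‖`. One contains
the other and their probabilities agree. -/
theorem IsRandomNetwork.established_ae_eq [IsProbabilityMeasure P]
    (hN : N.IsRandomNetwork P lamT lamO ρa)
    (hlamO : 0 ≤ lamO) (hθc : 0 < θc) (hk : k * θc = θ) (hθ : θ ≤ 2 * π)
    (hK : ⌈θ / θc⌉₊ = k) {j : ℕ} (hj : j < k) {z : ℂ} (hz : z ∈ cohSector ψ θc j)
    (hzd : ‖z‖ ≤ d) :
    N.established ψ θ θc z =ᵐ[P]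
      {ω | ‖z‖ ≤ clearance (cohSector ψ θc j) d (fun m => N.obs m ω)} := by
  have hd : 0 ≤ d := (norm_nonneg z).trans hzd
  refine ae_eq_of_subset_of_measure_ge ?_ ?_
    (hN.measurableSet_established hθc hk hθ hK z).nullMeasurableSet (measure_ne_top _ _)
  · intro ω hω
    rw [mem_established_iff hθc hk hθ hK hj hz] at hω
    exact (le_clearance_iff hd hzd).2 fun m hm => hω m ⟨hm.1, le_of_lt (mem_ofPred.1 hm.2)⟩
  · rw [hN.measure_established hlamO hθc hk hθ hK hj hz,
      hN.measure_le_clearance_cohSector hlamO hd hθc hk hθ hj (norm_nonneg z) hzd]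

theorem measurableSet_noCollision (hθc : 0 < θc) (hk : k * θc = θ) (hθ : θ ≤ 2 * π)
    (hK : ⌈θ / θc⌉₊ = k) :
    MeasurableSet {p : (ℕ → ℂ) × ((ℕ → ℂ) × (ℕ → Bool) × (ℕ → ℝ)) | ∀ n, ¬ (p.2.2.1 n = true ∧
      InnerProductGeometry.angle (Complex.exp (p.2.2.2 n * Complex.I)) (0 - p.2.1 n) ≤ θ / 2 ∧
      p.2.1 n ∈ visibleRegion ψ θ θc d p.1)} := by
  simp only [ofPred_forall]
  refine MeasurableSet.iInter fun n => MeasurableSet.compl ?_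
  have hm : Measurable fun p : (ℕ → ℂ) × ((ℕ → ℂ) × (ℕ → Bool) × (ℕ → ℝ)) =>
      InnerProductGeometry.angle (Complex.exp (p.2.2.2 n * Complex.I)) (0 - p.2.1 n) := by
    unfold InnerProductGeometry.angle
    fun_prop
  have ha : Measurable fun p : (ℕ → ℂ) × ((ℕ → ℂ) × (ℕ → Bool) × (ℕ → ℝ)) => p.2.2.1 n := by
    fun_prop
  have ht : Measurable fun p : (ℕ → ℂ) × ((ℕ → ℂ) × (ℕ → Bool) × (ℕ → ℝ)) => (p.2.1 n, p.1) := by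
    fun_prop
  exact (ha (measurableSet_singleton true)).inter
    ((hm measurableSet_Iic).inter (ht (measurableSet_visibleRegion_prod hθc hk hθ hK)))

theorem IsRandomNetwork.measurable_marks (hN : N.IsRandomNetwork P lamT lamO ρa) :
    Measurable fun ω => ((fun n => N.tx n ω), (fun n => N.act n ω), (fun n => N.dir n ω)) :=
  (measurable_pi_lambda _ hN.poisson_tx.measurable).prodMk
    ((measurable_pi_lambda _ hN.measurable_act).prodMk
      (measurable_pi_lambda _ hN.measurable_dir))

theorem IsRandomNetwork.measurableSet_compl_collision (hN : N.IsRandomNetwork P lamT lamO ρa)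
    (hθc : 0 < θc) (hk : k * θc = θ) (hθ : θ ≤ 2 * π) (hK : ⌈θ / θc⌉₊ = k) :
    MeasurableSet (N.collision ψ θ θc d)ᶜ := by
  have h := ((measurable_pi_lambda _ hN.poisson_obs.measurable).prodMk hN.measurable_marks)
    (measurableSet_noCollision (ψ := ψ) (d := d) hθc hk hθ hK)
  convert h using 1
  ext ω
  exact mem_compl_collision_iff ω

/-- Conditioning on the obstacles. -/
theorem IsRandomNetwork.measure_established_inter_compl_collision [IsProbabilityMeasure P]
    (hN : N.IsRandomNetwork P lamT lamO ρa) (hlamT : 0 ≤ lamT) (hρa : ρa ∈ Icc (0 : ℝ) 1)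
    (hθ0 : 0 ≤ θ) (hθc : 0 < θc) (hk : k * θc = θ) (hθ : θ ≤ 2 * π) (hK : ⌈θ / θc⌉₊ = k) (z : ℂ) :
    P (N.established ψ θ θc z ∩ (N.collision ψ θ θc d)ᶜ) =
      ∫⁻ ω in N.established ψ θ θc z, ENNReal.ofReal (exp (-(ρa * lamT * θ / (2 * π) *
        volume.real (visibleRegion ψ θ θc d (fun m => N.obs m ω))))) ∂P := by
  have hO : Measurable fun ω n => N.obs n ω := measurable_pi_lambda _ hN.poisson_obs.measurable
  have hE := hN.measurableSet_established (ψ := ψ) hθc hk hθ hK z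
  have hC := hN.measurableSet_compl_collision (ψ := ψ) (d := d) hθc hk hθ hK
  set A := {o : ℕ → ℂ | ∀ i < ⌈θ / θc⌉₊, z ∈ cohSector ψ θc i →
      ∀ m, o m ∈ cohSector ψ θc i → ‖z‖ < ‖o m‖} with hA
  have hAm : MeasurableSet A :=
    (measurable_const.prodMk measurable_id) (measurableSet_lineOfSight hθc hk hθ hK)
  set B := {p : (ℕ → ℂ) × ((ℕ → ℂ) × (ℕ → Bool) × (ℕ → ℝ)) | ∀ n, ¬ (p.2.2.1 n = true ∧
      InnerProductGeometry.angle (Complex.exp (p.2.2.2 n * Complex.I)) (0 - p.2.1 n) ≤ θ / 2 ∧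
      p.2.1 n ∈ visibleRegion ψ θ θc d p.1)} with hB
  have hBm : MeasurableSet B := measurableSet_noCollision hθc hk hθ hK
  set f : (ℕ → ℂ) × ((ℕ → ℂ) × (ℕ → Bool) × (ℕ → ℝ)) → ENNReal :=
    fun p => A.indicator 1 p.1 * B.indicator 1 p with hf
  have hfm : Measurable f :=
    ((measurable_one.indicator hAm).comp measurable_fst).mul (measurable_one.indicator hBm)
  -- Obstacles are independent of all transmitter data. Once they are frozen, the visible region is
  -- a deterministic set, and its void probability for the thinned transmitters applies.
  have h1 := lintegral_comp_prodMk_of_indepFun hO hN.measurable_marks hN.indep_network_obs.symm hfm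
  rw [← lintegral_indicator_one (hE.inter hC), ← lintegral_indicator hE]
  refine Eq.trans (lintegral_congr fun ω => ?_) (h1.trans (lintegral_congr fun ω => ?_))
  · have e1 : (N.established ψ θ θc z ∩ (N.collision ψ θ θc d)ᶜ).indicator (1 : Ω → ENNReal) ω =
      (N.established ψ θ θc z).indicator 1 ω * ((N.collision ψ θ θc d)ᶜ).indicator 1 ω := by
      rw [inter_indicator_one]
      rfl
    rw [e1]
    have e2 : ω ∈ (N.collision ψ θ θc d)ᶜ ↔ ((fun n => N.obs n ω),
        ((fun n => N.tx n ω), (fun n => N.act n ω), (fun n => N.dir n ω))) ∈ B :=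
      mem_compl_collision_iff ω
    congr 1
    by_cases h : ω ∈ (N.collision ψ θ θc d)ᶜ
    · rw [indicator_of_mem h, indicator_of_mem (e2.1 h), Pi.one_apply, Pi.one_apply]
    · rw [indicator_of_notMem h, indicator_of_notMem (mt e2.2 h)]
  · have hS : MeasurableSet {ω' | ∀ n, ¬ (N.act n ω' = true ∧
      InnerProductGeometry.angle (Complex.exp (N.dir n ω' * Complex.I)) (0 - N.tx n ω') ≤ θ / 2 ∧
      N.tx n ω' ∈ visibleRegion ψ θ θc d (fun m => N.obs m ω))} :=
        (measurable_const.prodMk hN.measurable_marks) hBm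
    have e2 : ∀ ω', f (fun n => N.obs n ω, (fun n => N.tx n ω', fun n => N.act n ω',
        fun n => N.dir n ω')) = A.indicator 1 (fun n => N.obs n ω) *
        {ω' | ∀ n, ¬ (N.act n ω' = true ∧
      InnerProductGeometry.angle (Complex.exp (N.dir n ω' * Complex.I)) (0 - N.tx n ω') ≤ θ / 2 ∧
      N.tx n ω' ∈ visibleRegion ψ θ θc d (fun m => N.obs m ω))}.indicator 1 ω' := fun ω' => rfl
    simp_rw [e2]
    rw [lintegral_const_mul _ (measurable_one.indicator hS), lintegral_indicator_one hS,
      hN.measure_void_thinned hlamT hρa (measurableSet_visibleRegion hθc hk hθ hK _)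
        (isBounded_visibleRegion _) (fun h => zero_notMem_sector _ _ h.1) hθ0 hθ]
    by_cases hω : ω ∈ N.established ψ θ θc z
    · have hω' : (fun n => N.obs n ω) ∈ A := hω
      rw [indicator_of_mem hω, indicator_of_mem hω', Pi.one_apply, one_mul]
    · have hω' : (fun n => N.obs n ω) ∉ A := hω
      rw [indicator_of_notMem hω, indicator_of_notMem hω', zero_mul]

/-- The area is a sum over coherence sectors, so its exponential is a product of functions of the
independent clearances; the link event affects only the factor of the sector containing `z`. -/
theorem IsRandomNetwork.measure_established_inter_compl_collision_eq [IsProbabilityMeasure P]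
    (hN : N.IsRandomNetwork P lamT lamO ρa) (hlamT : 0 ≤ lamT) (hlamO : 0 < lamO)
    (hρa : ρa ∈ Icc (0 : ℝ) 1)
    (hθ0 : 0 ≤ θ) (hθc : 0 < θc) (hk : k * θc = θ) (hθ : θ ≤ 2 * π) (hK : ⌈θ / θc⌉₊ = k)
    {z : ℂ} (hz : z ∈ beamRegion ψ θ d) {lamI S : ℝ} (hlamI : lamI = ρa * lamT * θ / (2 * π))
    (hS : S = lamO + lamI) :
    P (N.established ψ θ θc z ∩ (N.collision ψ θ θc d)ᶜ) =
      ENNReal.ofReal (1 - lamI / S * (1 - exp (-(S * (θc / 2) * d ^ 2)))) ^ (k - 1) *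
      ENNReal.ofReal (exp (-(S * (θc / 2) * ‖z‖ ^ 2)) -
        lamI / S * (exp (-(S * (θc / 2) * ‖z‖ ^ 2)) - exp (-(S * (θc / 2) * d ^ 2)))) := by
  obtain ⟨j, hj, hzj⟩ := (mem_beam_iff_exists hθc hk hθ z).1 hz.1
  have hzd : ‖z‖ ≤ d := hz.2
  have hd : 0 ≤ d := (norm_nonneg z).trans hzd
  have hI0 : 0 ≤ lamI := by
    have := hρa.1
    rw [hlamI]; positivity
  have hO : Measurable fun ω n => N.obs n ω := measurable_pi_lambda _ hN.poisson_obs.measurable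
  set Y : Fin k → Ω → ℝ := fun i ω => clearance (cohSector ψ θc i) d (fun m => N.obs m ω) with hY
  have hYm : ∀ i, Measurable (Y i) := fun i =>
    (measurable_clearance (measurableSet_cohSector hθc hk hθ i.2)).comp hO
  have hind : iIndepFun Y P := hN.poisson_obs.iIndepFun_clearance hd
    (fun i => measurableSet_cohSector hθc hk hθ i.2)
    (fun i i' hij => disjoint_cohSector hθc hk hθ i.2 i'.2 fun h => hij (Fin.ext h))
  -- The threshold `0` in the other sectors is no restriction, since clearances are nonnegative; one
  -- formula then covers all factors.
  set g : Fin k → ℝ → ENNReal := fun i => (Ici (if i = ⟨j, hj⟩ then ‖z‖ else 0)).indicator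
    fun y => ENNReal.ofReal (exp (-(lamI * (θc / 2) * y ^ 2))) with hg
  have hgm : ∀ i, Measurable (g i) := fun i => Measurable.indicator (by fun_prop) measurableSet_Ici
  have hexp : ∀ (i : Fin k) (l : ℝ), 0 ≤ l → l ≤ d →
      ∫⁻ ω, (Ici l).indicator
        (fun y => ENNReal.ofReal (exp (-(lamI * (θc / 2) * y ^ 2)))) (Y i ω) ∂P =
      ENNReal.ofReal (exp (-(S * (θc / 2) * l ^ 2)) -
        lamI / S * (exp (-(S * (θc / 2) * l ^ 2)) - exp (-(S * (θc / 2) * d ^ 2)))) := by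
    intro i l hl hld
    have h := setLIntegral_exp_of_tail (hYm i) (μ := lamO * (θc / 2)) (ν := lamI * (θc / 2))
      (by positivity) (by positivity) (fun ω => clearance_nonneg hd) (fun ω => clearance_le hd)
      (fun y hy0 hy => hN.measure_le_clearance_cohSector hlamO.le hd hθc hk hθ i.2 hy0 hy) hl hld
    rw [← lintegral_indicator (measurableSet_le measurable_const (hYm i)), ← add_mul,
      mul_div_mul_right _ _ (by positivity), ← hS] at h
    exact h
  rw [hN.measure_established_inter_compl_collision hlamT hρa hθ0 hθc hk hθ hK z,
    setLIntegral_congr (hN.established_ae_eq hlamO.le hθc hk hθ hK hj hzj hzd),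
    ← lintegral_indicator (measurableSet_le measurable_const (hYm ⟨j, hj⟩))]
  have hprod : ∀ ω, {ω | ‖z‖ ≤ Y ⟨j, hj⟩ ω}.indicator (fun ω => ENNReal.ofReal
      (exp (-(ρa * lamT * θ / (2 * π) *
        volume.real (visibleRegion ψ θ θc d (fun m => N.obs m ω)))))) ω =
      ∏ i, (g i ∘ Y i) ω := by
    intro ω
    by_cases hω : ‖z‖ ≤ Y ⟨j, hj⟩ ω
    · rw [indicator_of_mem (show ω ∈ {ω | ‖z‖ ≤ Y ⟨j, hj⟩ ω} from hω),
        volume_real_visibleRegion hθc hk hθ hK hd, ← hlamI, Finset.mul_sum,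
        ← Finset.sum_neg_distrib, Real.exp_sum,
        ENNReal.ofReal_prod_of_nonneg fun i _ => (Real.exp_pos _).le]
      refine Finset.prod_congr rfl fun i _ => ?_
      have hmem : Y i ω ∈ Ici (if i = ⟨j, hj⟩ then ‖z‖ else 0) := by
        split_ifs with h
        · subst h; exact hω
        · exact clearance_nonneg hd
      rw [Function.comp_apply, hg]
      simp only
      rw [indicator_of_mem hmem, mul_assoc]
    · rw [indicator_of_notMem (show ω ∉ {ω | ‖z‖ ≤ Y ⟨j, hj⟩ ω} from hω)]
      refine (Finset.prod_eq_zero (Finset.mem_univ ⟨j, hj⟩) ?_).symm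
      rw [Function.comp_apply, hg]
      simp only [if_true]
      exact indicator_of_notMem hω _
  refine (lintegral_congr hprod).trans ?_
  rw [lintegral_prod_eq_prod_lintegral_of_indepFun Finset.univ _ (hind.comp g hgm)
    (fun i => (hgm i).comp (hYm i)), ← Finset.prod_erase_mul _ _ (Finset.mem_univ ⟨j, hj⟩)]
  congr 1
  · rw [Finset.prod_congr rfl fun i hi => ?_, Finset.prod_const,
      Finset.card_erase_of_mem (Finset.mem_univ _), Finset.card_univ, Fintype.card_fin]
    have h := hexp i 0 le_rfl hd
    simp only [hg, Finset.ne_of_mem_erase hi, if_false, Function.comp_apply]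
    rw [h]
    congr 1
    simp
  · simp only [hg, if_true, Function.comp_apply]
    exact hexp ⟨j, hj⟩ ‖z‖ (norm_nonneg z) hzd

end Network

/-! ### Closed form of the conditional collision probability -/

namespace Network

variable {Ω : Type*} [MeasurableSpace Ω] {P : Measure Ω} [IsProbabilityMeasure P] {N : Network Ω}
  {lamT lamO ρa ψ θ θc d : ℝ} {k : ℕ}

theorem IsRandomNetwork.condCollisionProb_eq (hN : N.IsRandomNetwork P lamT lamO ρa)
    (hlamT : 0 ≤ lamT) (hlamO : 0 < lamO) (hρa : ρa ∈ Icc (0 : ℝ) 1) (hθ0 : 0 ≤ θ) (hθc : 0 < θc)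
    (hk : k * θc = θ) (hθ : θ ≤ 2 * π) (hK : ⌈θ / θc⌉₊ = k) {z : ℂ} (hz : z ∈ beamRegion ψ θ d)
    {lamI : ℝ} (hlamI : lamI = ρa * lamT * θ / (2 * π)) :
    0 < P (N.established ψ θ θc z) ∧
      N.condCollisionProb P ψ θ θc d z = condFormula lamI lamO θ θc d ‖z‖ := by
  obtain ⟨j, hj, hzj⟩ := (mem_beam_iff_exists hθc hk hθ z).1 hz.1
  have hPE := hN.measure_established hlamO.le hθc hk hθ hK hj hzj
  have hpos : 0 < P (N.established ψ θ θc z) := by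
    rw [hPE]
    exact ENNReal.ofReal_pos.2 (exp_pos _)
  have hI0 : 0 ≤ lamI := by
    have := hρa.1
    rw [hlamI]; positivity
  have hS : 0 < lamO + lamI := by linarith
  refine ⟨hpos, ?_⟩
  have hcond := cond_isProbabilityMeasure (μ := P) hpos.ne'
  have hC : MeasurableSet (N.collision ψ θ θc d) := by
    simpa using (hN.measurableSet_compl_collision (ψ := ψ) (d := d) hθc hk hθ hK).compl
  have h1 := probReal_compl_eq_one_sub (μ := P[|N.established ψ θ θc z]) hC
  have h2 : N.condCollisionProb P ψ θ θc d z =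
      1 - (P[|N.established ψ θ θc z]).real (N.collision ψ θ θc d)ᶜ := by
    rw [h1, condCollisionProb]
    ring
  rw [h2, measureReal_def, cond_apply (hN.measurableSet_established hθc hk hθ hK z),
    hN.measure_established_inter_compl_collision_eq hlamT hlamO hρa hθ0 hθc hk hθ hK hz hlamI rfl,
    hPE, condFormula, hK]
  have e1 : 1 - lamI / (lamO + lamI) * (1 - exp (-((lamO + lamI) * (θc / 2) * d ^ 2))) =
      (lamO + lamI * exp (-(lamO + lamI) * (θc * d ^ 2 / 2))) / (lamO + lamI) := by
    rw [show -((lamO + lamI) * (θc / 2) * d ^ 2) = -(lamO + lamI) * (θc * d ^ 2 / 2) by ring]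
    field_simp
    ring
  have e2 : ∀ a b : ℝ, a - lamI / (lamO + lamI) * (a - b) =
      (lamO * a + lamI * b) / (lamO + lamI) := by
    intro a b
    field_simp
    ring
  have n1 : 0 ≤ (lamO + lamI * exp (-(lamO + lamI) * (θc * d ^ 2 / 2))) / (lamO + lamI) := by
    positivity
  have e3 : exp (-(lamI * (θc * ‖z‖ ^ 2 / 2))) * exp (-(lamO * (θc / 2) * ‖z‖ ^ 2)) =
      exp (-((lamO + lamI) * (θc / 2) * ‖z‖ ^ 2)) := by
    rw [← Real.exp_add]
    congr 1
    ring
  -- The factor `exp (λ_o A_ℓ)` in the formula is the reciprocal of the probability that the link is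
  -- established.
  have e4 : exp (lamO * (θc * ‖z‖ ^ 2 / 2)) * exp (-(lamO * (θc / 2) * ‖z‖ ^ 2)) = 1 := by
    rw [← Real.exp_add, ← Real.exp_zero]
    congr 1
    ring
  rw [e1, ENNReal.toReal_mul, ENNReal.toReal_inv, ENNReal.toReal_mul, ENNReal.toReal_pow,
    ENNReal.toReal_ofReal (exp_pos _).le, ENNReal.toReal_ofReal n1,
    ENNReal.toReal_ofReal (by rw [e2]; positivity), mul_left_comm]
  congr 2
  rw [inv_mul_eq_div, div_eq_iff (exp_pos _).ne',
    show -(lamO + lamI) * (θc * ‖z‖ ^ 2 / 2) = -((lamO + lamI) * (θc / 2) * ‖z‖ ^ 2) by ring,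
    show -(lamO + lamI) * (θc * d ^ 2 / 2) = -((lamO + lamI) * (θc / 2) * d ^ 2) by ring,
    sub_mul, show -lamI * (θc * ‖z‖ ^ 2 / 2) = -(lamI * (θc * ‖z‖ ^ 2 / 2)) by ring, e3]
  congr 1
  generalize exp (-((lamO + lamI) * (θc / 2) * ‖z‖ ^ 2)) -
    exp (-((lamO + lamI) * (θc / 2) * d ^ 2)) = D
  linear_combination (-(lamI / (lamO + lamI) * D)) * e4

end Network

/-! ### Length of the typical link -/

section Link

variable {ψ θ d : ℝ}

theorem measurableSet_beamRegion (hθ : θ ≤ 2 * π) : MeasurableSet (beamRegion ψ θ d) :=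
  measurableSet_inter_norm_le (measurableSet_sector (by linarith)) d

theorem volume_beamRegion (hθ : θ ≤ 2 * π) (hd : 0 ≤ d) :
    volume (beamRegion ψ θ d) = ENNReal.ofReal (θ * d ^ 2 / 2) := by
  have h := volume_sector_inter_le (a := ψ) (b := ψ + θ) (by linarith) hd
  rwa [add_sub_cancel_left] at h

/-- In polar coordinates the points with norm in `S` have area `θ ∫ r dr` over `S ∩ (0, d]`;
division by the total area `θ d ^ 2 / 2` leaves the density `2 r / d ^ 2`. -/
theorem map_norm_typicalTxLaw (hθ0 : 0 < θ) (hθ : θ ≤ 2 * π) (hd : 0 < d) :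
    (typicalTxLaw ψ θ d).map (fun z => ‖z‖) =
      (volume.restrict (Ioc 0 d)).withDensity (fun l => ENNReal.ofReal (2 * l / d ^ 2)) := by
  ext S hS
  have hSm : MeasurableSet ((fun z : ℂ => ‖z‖) ⁻¹' S) := measurable_norm hS
  have e : beamRegion ψ θ d ∩ (fun z : ℂ => ‖z‖) ⁻¹' S =
      sector ψ (ψ + θ) ∩ (fun z : ℂ => ‖z‖) ⁻¹' (Iic d ∩ S) := by
    ext z
    exact and_assoc
  have e2 : Iic d ∩ S ∩ Ioi 0 = S ∩ Ioc 0 d := by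
    ext r
    simp only [mem_inter_iff, mem_Iic, mem_Ioi, mem_Ioc]
    tauto
  rw [Measure.map_apply measurable_norm hS, typicalTxLaw, cond_apply (measurableSet_beamRegion hθ),
    volume_beamRegion hθ hd.le, e,
    volume_sector_inter_preimage_norm (by linarith) (measurableSet_Iic.inter hS), e2,
    withDensity_apply _ hS, Measure.restrict_restrict hS, ← mul_assoc, add_sub_cancel_left,
    ← ENNReal.ofReal_inv_of_pos (by positivity), ← ENNReal.ofReal_mul (by positivity),
    ← lintegral_const_mul _ (by fun_prop)]
  refine lintegral_congr fun r => ?_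
  rw [← ENNReal.ofReal_mul (by positivity)]
  congr 1
  field_simp

theorem integral_typicalTxLaw_norm (hθ0 : 0 < θ) (hθ : θ ≤ 2 * π) (hd : 0 < d) {f : ℝ → ℝ}
    (hf : Measurable f) :
    ∫ z, f ‖z‖ ∂typicalTxLaw ψ θ d = ∫ l in (0 : ℝ)..d, f l * (2 * l / d ^ 2) := by
  rw [← integral_map (f := f) (φ := fun z : ℂ => ‖z‖) measurable_norm.aemeasurable
      hf.aestronglyMeasurable,
    map_norm_typicalTxLaw hθ0 hθ hd, integral_withDensity_eq_integral_toReal_smul (by fun_prop)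
      (ae_of_all _ fun _ => ENNReal.ofReal_lt_top), intervalIntegral.integral_of_le hd.le]
  refine setIntegral_congr_fun measurableSet_Ioc fun l hl => ?_
  have : 0 < l := hl.1
  rw [ENNReal.toReal_ofReal (by positivity), smul_eq_mul, mul_comm]

end Link

theorem continuous_condFormula (lamI lamO θ θc d : ℝ) :
    Continuous (condFormula lamI lamO θ θc d) := by
  unfold condFormula
  fun_prop

end MmWave

/-! ### Averaging over the typical transmitter -/

theorem proposition1 {Ω : Type*} [MeasurableSpace Ω] (P : Measure Ω) [IsProbabilityMeasure P]
    (N : MmWave.Network Ω) (lamT lamO ρa lamI ψ θ θc dmax : ℝ)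
    (hlamT : 0 < lamT) (hlamO : 0 < lamO) (hρa : ρa ∈ Set.Icc (0 : ℝ) 1)
    (hθ : 0 < θ) (hθ_le : θ ≤ 2 * Real.pi) (hθc : 0 < θc) (hint : ∃ k : ℕ, θ / θc = k)
    (hdmax : 0 < dmax)
    (hlamI : lamI = ρa * lamT * θ / (2 * Real.pi))
    (hN : N.IsRandomNetwork P lamT lamO ρa) :
    (∀ z ∈ MmWave.beamRegion ψ θ dmax,
      0 < P (N.established ψ θ θc z) ∧
      N.condCollisionProb P ψ θ θc dmax z = MmWave.condFormula lamI lamO θ θc dmax ‖z‖) ∧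
    (MmWave.typicalTxLaw ψ θ dmax).map (fun z => ‖z‖) =
      (volume.restrict (Set.Ioc 0 dmax)).withDensity
        (fun l => ENNReal.ofReal (2 * l / dmax ^ 2)) ∧
    N.collisionProb P ψ θ θc dmax =
      (∫ l in (0 : ℝ)..dmax, MmWave.condFormula lamI lamO θ θc dmax l * (2 * l / dmax ^ 2)) ∧
    N.collisionProb P ψ θ θc dmax =
      1 - ∫ l in (0 : ℝ)..dmax,
        ((lamO + lamI * Real.exp (-(lamO + lamI) * (θc * dmax ^ 2 / 2))) / (lamO + lamI))
            ^ (⌈θ / θc⌉₊ - 1) *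
          (Real.exp (-lamI * (θc * l ^ 2 / 2)) -
            lamI * Real.exp (lamO * (θc * l ^ 2 / 2)) / (lamO + lamI) *
              (Real.exp (-(lamO + lamI) * (θc * l ^ 2 / 2)) -
                Real.exp (-(lamO + lamI) * (θc * dmax ^ 2 / 2)))) *
          (2 * l / dmax ^ 2) := by
  obtain ⟨k, hk⟩ := hint
  have hK : ⌈θ / θc⌉₊ = k := by rw [hk, Nat.ceil_natCast]
  have hk' : k * θc = θ := by rw [← hk, div_mul_cancel₀ _ hθc.ne']
  have h1 : ∀ z ∈ MmWave.beamRegion ψ θ dmax, 0 < P (N.established ψ θ θc z) ∧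
      N.condCollisionProb P ψ θ θc dmax z = MmWave.condFormula lamI lamO θ θc dmax ‖z‖ :=
    fun z hz => hN.condCollisionProb_eq hlamT.le hlamO hρa hθ.le hθc hk' hθ_le hK hz hlamI
  have h3 : N.collisionProb P ψ θ θc dmax =
      ∫ l in (0 : ℝ)..dmax, MmWave.condFormula lamI lamO θ θc dmax l * (2 * l / dmax ^ 2) := by
    rw [← MmWave.integral_typicalTxLaw_norm hθ hθ_le hdmax
      (MmWave.continuous_condFormula lamI lamO θ θc dmax).measurable]
    -- The closed form is available only on the beam region, which carries all the mass of the
    -- uniform law.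
    exact integral_congr_ae ((ae_cond_mem (MmWave.measurableSet_beamRegion hθ_le)).mono
      fun z hz => (h1 z hz).2)
  refine ⟨h1, MmWave.map_norm_typicalTxLaw hθ hθ_le hdmax, h3, ?_⟩
  -- The density has total mass one, which lets the leading `1` of `condFormula` leave the integral.
  have hw : ∫ l in (0 : ℝ)..dmax, 2 * l / dmax ^ 2 = 1 := by
    rw [intervalIntegral.integral_div, intervalIntegral.integral_const_mul, integral_id]
    field_simp
    ring
  rw [h3, ← hw, ← intervalIntegral.integral_sub]
  · refine intervalIntegral.integral_congr fun l _ => ?_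
    simp only [MmWave.condFormula]
    ring
  · exact Continuous.intervalIntegrable (by fun_prop) _ _
  · exact Continuous.intervalIntegrable (by fun_prop) _ _
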